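/- Let $n\ge 1$ and let $\mathfrak h$ be an abelian Lie subalgebra of $\mathfrak{sl}(n,\mathbb R)$. Put $\mathfrak B_{\mathfrak h}:=\mathbb R\,\mathbb I_{\mathbb R^n}\oplus\mathfrak h\subset\mathfrak{gl}(n,\mathbb R)$, and let $\mathfrak B_{\mathfrak h}\ltimes\mathbb R^n$ be the real Lie algebra with underlying space $\mathfrak B_{\mathfrak h}\oplus\mathbb R^n$ and bracket $[a,b]=ab-ba=0$, $[x,y]=0$, $[a,x]=ax$ for $a,b\in\mathfrak B_{\mathfrak h}$, $x,y\in\mathbb R^n$. Let $\mathfrak h^+$ (the toroidal part) be the subspace of those $x\in\mathfrak h$ for which all complex eigenvalues of $\operatorname{ad}x$ acting on $\mathfrak{sl}(n,\mathbb R)$ are purely imaginary (zero included), and let $\mathfrak h^-$ (the vector part) be the subspace of those $x\in\mathfrak h$ for which all complex eigenvalues of $\operatorname{ad}x$ are real. For $\mathbb K=\mathbb R$ or $\mathbb C$ let $\mathfrak{aff}(\mathbb K)=\left\{\begin{pmatrix}z_1&z_2\\0&0\end{pmatrix}: z_1,z_2\in\mathbb K\right\}$, regarded as a real Lie algebra.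 Then the following are equivalent: (a) $\mathfrak h$ is a Cartan subalgebra of $\mathfrak{sl}(n,\mathbb R)$, i.e. it is nilpotent and equal to its own normalizer; (b) $\mathfrak B_{\mathfrak h}=\mathbb R[M]$, the algebra of polynomials in $M$, for some nonderogatory real $n\times n$ matrix $M$ (its characteristic and minimal polynomials coincide) with $n$ distinct (real or complex) eigenvalues; (c) the Lie algebra $\mathfrak B_{\mathfrak h}\ltimes\mathbb R^n$ is isomorphic to the direct sum of $p$ copies of $\mathfrak{aff}(\mathbb C)$ and $q$ copies of $\mathfrak{aff}(\mathbb R)$, where $p=\dim\mathfrak h^+$ and $q=\dim\mathfrak h^--\dim\mathfrak h^++1$ (so that $2p+q=n$, by comparing dimensions). -/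

import Mathlib

attribute [local instance 100] LieRing.ofAssociativeRing

namespace CartanSl

open LieAlgebra

/-- The Lie algebra `sl(n, ℝ)` of real matrices of trace zero. -/
abbrev slR (n : ℕ) : LieSubalgebra ℝ (Matrix (Fin n) (Fin n) ℝ) :=
  SpecialLinear.sl (Fin n) ℝ

/-- `μ` is a (real or complex) eigenvalue of the real linear operator `f`: it is an eigenvalue
of the complexification of `f`. -/
def IsComplexEigenvalue {V : Type*} [AddCommGroup V] [Module ℝ V] (f : Module.End ℝ V)
    (μ : ℂ) : Prop :=
  Module.End.HasEigenvalue (LinearMap.baseChange ℂ f : Module.End ℂ (TensorProduct ℝ ℂ V)) μ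

section AdPart

open Module.End

theorem mem_add_of_commute {V : Type*} [AddCommGroup V] [Module ℝ V] [FiniteDimensional ℝ V]
    {f g : Module.End ℝ V} (hfg : Commute f g) (S : Submodule ℝ ℂ)
    (hf : ∀ μ, IsComplexEigenvalue f μ → μ ∈ S) (hg : ∀ μ, IsComplexEigenvalue g μ → μ ∈ S)
    (μ : ℂ) (h : IsComplexEigenvalue (f + g) μ) : μ ∈ S := by
  set F : Module.End ℂ (TensorProduct ℝ ℂ V) := LinearMap.baseChange ℂ f with hF
  set G : Module.End ℂ (TensorProduct ℝ ℂ V) := LinearMap.baseChange ℂ g with hG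
  have hFG : F * G = G * F := by
    rw [hF, hG, ← LinearMap.baseChange_mul, ← LinearMap.baseChange_mul, hfg.eq]
  have h' : HasEigenvalue (F + G) μ := by
    have := h
    rwa [IsComplexEigenvalue, LinearMap.baseChange_add] at this
  have hcomm : Commute (F + G) F := by
    show (F + G) * F = F * (F + G)
    rw [add_mul, mul_add, hFG]
  have hmaps := mapsTo_genEigenspace_of_comm hcomm μ 1
  have hne : Nontrivial (eigenspace (F + G) μ) :=
    Submodule.nontrivial_iff_ne_bot.mpr h'
  obtain ⟨l, hl⟩ := Module.End.exists_eigenvalue (F.restrict hmaps)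
  obtain ⟨v, hv⟩ := hl.exists_hasEigenvector
  have hv0 : (v : TensorProduct ℝ ℂ V) ≠ 0 := fun h0 => hv.2 (Subtype.ext h0)
  have hFv : F v = l • (v : TensorProduct ℝ ℂ V) := by
    exact congrArg Subtype.val hv.apply_eq_smul
  have hsum : (F + G) v = μ • (v : TensorProduct ℝ ℂ V) := mem_eigenspace_iff.mp v.2
  have hGv : G v = (μ - l) • (v : TensorProduct ℝ ℂ V) := by
    rw [LinearMap.add_apply, hFv] at hsum
    rw [sub_smul, ← hsum]; abel
  have h1 : l ∈ S := hf l (hasEigenvalue_of_hasEigenvector ⟨mem_eigenspace_iff.mpr hFv, hv0⟩)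
  have h2 : μ - l ∈ S :=
    hg _ (hasEigenvalue_of_hasEigenvector ⟨mem_eigenspace_iff.mpr hGv, hv0⟩)
  simpa using S.add_mem h1 h2

theorem mem_smul {V : Type*} [AddCommGroup V] [Module ℝ V]
    {f : Module.End ℝ V} (S : Submodule ℝ ℂ) (c : ℝ)
    (hf : ∀ μ, IsComplexEigenvalue f μ → μ ∈ S)
    (μ : ℂ) (h : IsComplexEigenvalue (c • f) μ) : μ ∈ S := by
  obtain ⟨v, hv⟩ := HasEigenvalue.exists_hasEigenvector h
  have h1 := hv.apply_eq_smul
  rw [LinearMap.baseChange_smul, LinearMap.smul_apply] at h1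
  rcases eq_or_ne c 0 with rfl | hc
  · rw [zero_smul] at h1
    rcases smul_eq_zero.mp h1.symm with h0 | h0
    · rw [h0]; exact S.zero_mem
    · exact absurd h0 hv.2
  · have h2 : IsComplexEigenvalue f (c⁻¹ • μ) := by
      refine hasEigenvalue_of_hasEigenvector ⟨mem_eigenspace_iff.mpr ?_, hv.2⟩
      rw [smul_assoc, ← h1, smul_smul, inv_mul_cancel₀ hc, one_smul]
    have := S.smul_mem c (hf _ h2)
    rwa [smul_smul, mul_inv_cancel₀ hc, one_smul] at this

/-- For an abelian subalgebra `h` of a real Lie algebra `L` and a real subspace `S` of `ℂ`: the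
subspace of all `x ∈ h` such that every complex eigenvalue of the operator `ad x` of `L` lies
in `S`. -/
def adPart {L : Type*} [LieRing L] [LieAlgebra ℝ L] [FiniteDimensional ℝ L]
    (h : LieSubalgebra ℝ L) [IsLieAbelian h] (S : Submodule ℝ ℂ) : Submodule ℝ L where
  carrier := {x | x ∈ h ∧ ∀ μ : ℂ, IsComplexEigenvalue (ad ℝ L x) μ → μ ∈ S}
  zero_mem' := by
    refine ⟨h.zero_mem, fun μ hμ => ?_⟩
    refine mem_smul (f := ad ℝ L 0) ⊥ 0 ?_ μ ?_ |> fun h0 => by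
      rw [(Submodule.mem_bot ℝ).mp h0]; exact S.zero_mem
    · intro ν hν
      obtain ⟨v, hv⟩ := HasEigenvalue.exists_hasEigenvector hν
      have h1 := hv.apply_eq_smul
      rw [map_zero, LinearMap.baseChange_zero, LinearMap.zero_apply] at h1
      exact (smul_eq_zero.mp h1.symm).resolve_right hv.2
    · simpa using hμ
  add_mem' := by
    rintro x y ⟨hx, hx'⟩ ⟨hy, hy'⟩
    refine ⟨h.add_mem hx hy, fun μ hμ => ?_⟩
    have hxy : ⁅x, y⁆ = 0 := by
      have := trivial_lie_zero h h (⟨x, hx⟩ : h) ⟨y, hy⟩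
      exact congrArg Subtype.val this
    have hc : Commute (ad ℝ L x) (ad ℝ L y) := by
      have : ⁅ad ℝ L x, ad ℝ L y⁆ = 0 := by rw [← LieHom.map_lie, hxy, map_zero]
      rw [LieRing.of_associative_ring_bracket] at this
      exact sub_eq_zero.mp this
    rw [map_add] at hμ
    exact mem_add_of_commute hc S hx' hy' μ hμ
  smul_mem' := by
    rintro c x ⟨hx, hx'⟩
    refine ⟨h.smul_mem c hx, fun μ hμ => ?_⟩
    rw [map_smul] at hμ
    exact mem_smul S c hx' μ hμ

end AdPart

/-- The toroidal part of `h`: the elements `x` of `h` for which every eigenvalue of `ad x` is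
purely imaginary. -/
noncomputable def toroidalPart {L : Type*} [LieRing L] [LieAlgebra ℝ L] [FiniteDimensional ℝ L]
    (h : LieSubalgebra ℝ L) [IsLieAbelian h] : Submodule ℝ L :=
  adPart h (LinearMap.ker Complex.reLm)

/-- The vector part of `h`: the elements `x` of `h` for which every eigenvalue of `ad x` is
real. -/
noncomputable def vectorPart {L : Type*} [LieRing L] [LieAlgebra ℝ L] [FiniteDimensional ℝ L]
    (h : LieSubalgebra ℝ L) [IsLieAbelian h] : Submodule ℝ L :=
  adPart h (LinearMap.ker Complex.imLm)

/-- The Lie subalgebra `ℝ I ⊕ h` of `gl(n, ℝ)`, for a Lie subalgebra `h` of `sl(n, ℝ)`. -/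
def scalarsPlus {n : ℕ} (h : LieSubalgebra ℝ (slR n)) :
    LieSubalgebra ℝ (Matrix (Fin n) (Fin n) ℝ) where
  toSubmodule := Submodule.span ℝ {1} ⊔ (h.map (slR n).incl).toSubmodule
  lie_mem' := by
    intro a b ha hb
    obtain ⟨a₁, ha₁, a₂, ha₂, rfl⟩ := Submodule.mem_sup.mp ha
    obtain ⟨b₁, hb₁, b₂, hb₂, rfl⟩ := Submodule.mem_sup.mp hb
    obtain ⟨c, rfl⟩ := Submodule.mem_span_singleton.mp ha₁
    obtain ⟨d, rfl⟩ := Submodule.mem_span_singleton.mp hb₁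
    have key : ⁅c • (1 : Matrix (Fin n) (Fin n) ℝ) + a₂, d • 1 + b₂⁆ = ⁅a₂, b₂⁆ := by
      simp only [LieRing.of_associative_ring_bracket, add_mul, mul_add, smul_mul_assoc,
        mul_smul_comm, one_mul, mul_one, smul_add]
      rw [smul_comm d c]
      abel
    show ⁅c • (1 : Matrix (Fin n) (Fin n) ℝ) + a₂, d • 1 + b₂⁆ ∈ _
    rw [key]
    exact Submodule.mem_sup_right ((h.map (slR n).incl).lie_mem ha₂ hb₂)

/-- The action of a Lie algebra `B` of `n × n` matrices on the abelian Lie algebra `ℝⁿ` (the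
commutator bracket of the commutative ring `Fin n → ℝ` is zero), by multiplication of matrices and
vectors. -/
def mulVecDer {n : ℕ} (B : LieSubalgebra ℝ (Matrix (Fin n) (Fin n) ℝ)) :
    B →ₗ⁅ℝ⁆ LieDerivation ℝ (Fin n → ℝ) (Fin n → ℝ) where
  toFun a :=
    { toLinearMap := (a : Matrix (Fin n) (Fin n) ℝ).mulVecLin
      leibniz' := fun x y => by
        simp [LieRing.of_associative_ring_bracket, mul_comm] }
  map_add' a b := by
    ext1 v
    exact Matrix.add_mulVec _ _ v
  map_smul' c a := by
    ext1 v
    exact Matrix.smul_mulVec c _ v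
  map_lie' {a b} := by
    ext1 v
    show (⁅(a : Matrix (Fin n) (Fin n) ℝ), (b : Matrix (Fin n) (Fin n) ℝ)⁆).mulVec v =
      (a : Matrix (Fin n) (Fin n) ℝ).mulVec ((b : Matrix (Fin n) (Fin n) ℝ).mulVec v) -
        (b : Matrix (Fin n) (Fin n) ℝ).mulVec ((a : Matrix (Fin n) (Fin n) ℝ).mulVec v)
    rw [LieRing.of_associative_ring_bracket, Matrix.sub_mulVec, Matrix.mulVec_mulVec,
      Matrix.mulVec_mulVec]

/-- The semidirect sum `B ⋉ ℝⁿ`, with `[a, b] = ab - ba`, `[x, y] = 0` and `[a, x] = a x` for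
`a, b ∈ B` and `x, y ∈ ℝⁿ`. -/
abbrev semidirect {n : ℕ} (B : LieSubalgebra ℝ (Matrix (Fin n) (Fin n) ℝ)) : Type :=
  SemiDirectSum (Fin n → ℝ) B (mulVecDer B)

/-- The real Lie algebra `aff(𝕂)` (`𝕂 = ℝ` or `ℂ`) of the group of affine motions of the line `𝕂`:
the `2 × 2` matrices over `𝕂` whose second row is zero. -/
def aff (𝕂 : Type) [RCLike 𝕂] : LieSubalgebra ℝ (Matrix (Fin 2) (Fin 2) 𝕂) where
  carrier := {A | A 1 0 = 0 ∧ A 1 1 = 0}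
  zero_mem' := by simp
  add_mem' := by
    rintro A B ⟨h1, h2⟩ ⟨h3, h4⟩
    simp [h1, h2, h3, h4]
  smul_mem' := by
    rintro c A ⟨h1, h2⟩
    simp [h1, h2]
  lie_mem' := by
    rintro A B ⟨h1, h2⟩ ⟨h3, h4⟩
    simp [LieRing.of_associative_ring_bracket, Matrix.mul_apply, Fin.sum_univ_two, h1, h2, h3, h4]

/-- The matrix `M` is nonderogatory: its characteristic and minimal polynomials coincide. -/
def IsNonderogatory {n : ℕ} (M : Matrix (Fin n) (Fin n) ℝ) : Prop :=
  M.charpoly = minpoly ℝ M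

/-- The `n × n` real matrix `M` has `n` distinct (real or complex) eigenvalues. -/
def HasDistinctEigenvalues {n : ℕ} (M : Matrix (Fin n) (Fin n) ℝ) : Prop :=
  (spectrum ℂ (M.map (algebraMap ℝ ℂ))).ncard = n

end CartanSl

namespace CartanSl

open LieAlgebra Module

/-! ### Modules over reduced Artinian rings, and reduced real algebras -/

section ReducedAlgebra

/-! All three conditions say that `ℝ I ⊕ h` is the regular representation of some `A = ℂᵖ × ℝᵠ`
carried over to `ℝⁿ`; this is `IsMultiplicationAlgebra h`.

A Cartan `h` makes `B = ℝ I ⊕ h` its own centralizer, hence a commutative associative algebra. It is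
reduced: a nilpotent element of `B` is orthogonal to everything for the trace form. A nonderogatory
`M` with distinct eigenvalues makes `ℝ[M]` reduced of dimension `n`. In both cases the faithful
module `ℝⁿ` has a vector with zero annihilator, and its orbit map is an isomorphism
(`exists_range_mulMatrix_eq`).

Conversely, `A` is generated by an element with separable minimal polynomial of degree `n`, which
supplies `M`. Hence `A` has no nonzero derivation, so whatever normalizes `h` centralizes `B`, and
the regular representation is its own centralizer: `h` is Cartan.

For the Lie algebra condition, the sum of copies of `aff` is `A ⋉ A`, with `A` acting on itself by
multiplication; its derived algebra is the second factor, so an isomorphism recovers the regular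
representation. The dimensions of the toroidal and vector parts come from the eigenvalues of `ad x`,
which are differences of values of the `2p + q` characters of `A`. -/

theorem exists_forall_smul_eq_zero_imp {R V : Type*} [CommRing R] [IsArtinianRing R] [IsReduced R]
    [AddCommGroup V] [Module R V] [FaithfulSMul R V] :
    ∃ v : V, ∀ r : R, r • v = 0 → r = 0 := by
  classical
  let e := IsArtinianRing.equivPi R
  let ε : MaximalSpectrum R → R := fun I => e.symm (Pi.single I 1)
  have hε : ∀ I, ε I ≠ 0 := fun I h => by
    have h1 : (Pi.single I 1 : ∀ I : MaximalSpectrum R, R ⧸ I.asIdeal) = 0 := by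
      simpa only [ε, map_eq_zero_iff e.symm e.symm.injective] using h
    exact one_ne_zero (Pi.single_eq_zero_iff.mp h1)
  have hm : ∀ I, ∃ m : V, ε I • m ≠ 0 := fun I => by
    by_contra! h0
    exact hε I (FaithfulSMul.eq_of_smul_eq_smul (α := V) fun m => by simpa using h0 m)
  choose m hm using hm
  have : Fintype (MaximalSpectrum R) := Fintype.ofFinite _
  -- The primitive idempotents `ε I` separate the summands. If `r ≠ 0` has a nonzero component at
  -- `I`, some multiple of `r` is `ε I`, which would then kill `ε I • m I`.
  refine ⟨∑ I, ε I • m I, fun r hr => ?_⟩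
  by_contra hr0
  obtain ⟨I, hI⟩ : ∃ I, e r I ≠ 0 := by
    by_contra! h0
    exact hr0 ((map_eq_zero_iff e e.injective).mp (funext h0))
  let _ : Field (R ⧸ I.asIdeal) := Ideal.Quotient.field _
  obtain ⟨u, hu⟩ : ∃ u, e r I * u = 1 := ⟨_, mul_inv_cancel₀ hI⟩
  have hs : e.symm (Pi.single I u) * r = ε I := by
    apply e.injective
    rw [map_mul, e.apply_symm_apply, e.apply_symm_apply]
    rw [← Pi.single_mul_left, mul_comm, hu]
  have hsum : ε I • ∑ J, ε J • m J = ε I • m I := by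
    have hεε : ∀ J, ε I * ε J = if J = I then ε I else 0 := fun J => by
      rw [← map_mul]
      split_ifs with hJ
      · rw [hJ, ← Pi.single_mul_left, one_mul, Pi.single_eq_same]
      · rw [← Pi.single_mul_left, Pi.single_eq_of_ne (Ne.symm hJ), mul_zero, Pi.single_zero, map_zero]
    simp [Finset.smul_sum, smul_smul, hεε, ite_smul]
  apply hm I
  rw [← hsum, ← hs, mul_smul, hr, smul_zero]

/-- By semisimplicity `R v` has a complement, and the projection onto `R v` is multiplication by a
scalar. It fixes `v`, whose annihilator is zero, so the scalar is `1` and `R v = V`. -/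
theorem bijective_smul_of_forall_endomorphism {R V : Type*} [CommRing R] [IsArtinianRing R]
    [IsReduced R] [AddCommGroup V] [Module R V]
    (hV : ∀ f : V →ₗ[R] V, ∃ r : R, ∀ x, f x = r • x) {v : V} (hv : ∀ r : R, r • v = 0 → r = 0) :
    Function.Bijective fun r : R => r • v := by
  refine ⟨fun a b hab => ?_, fun x => ?_⟩
  · exact sub_eq_zero.mp (hv _ (by rw [sub_smul, sub_eq_zero]; exact hab))
  have : IsSemisimpleRing R := IsArtinianRing.isSemisimpleRing_of_isReduced R
  obtain ⟨W, hW⟩ := exists_isCompl (R ∙ v)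
  obtain ⟨r, hr⟩ := hV (Submodule.projection _ _ hW)
  have h1 : r • v = v := by
    rw [← hr]; exact Submodule.projection_apply_left hW ⟨v, Submodule.mem_span_singleton_self v⟩
  have h2 : r = 1 := sub_eq_zero.mp (hv _ (by rw [sub_smul, h1, one_smul, sub_self]))
  have h3 : Submodule.projection _ _ hW x ∈ R ∙ v := Submodule.projection_apply_mem hW x
  rw [hr, h2, one_smul] at h3
  exact Submodule.mem_span_singleton.mp h3

/-- A reduced Artinian ring is the product of its residue fields, and a finite field extension of
`ℝ` is `ℝ` or `ℂ`. -/
theorem exists_algEquiv_pi_complex_prod_pi_real (R : Type*) [CommRing R] [Algebra ℝ R]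
    [FiniteDimensional ℝ R] [IsReduced R] :
    ∃ p q : ℕ, Nonempty (((Fin p → ℂ) × (Fin q → ℝ)) ≃ₐ[ℝ] R) := by
  classical
  have : IsArtinianRing R := IsArtinianRing.of_finite ℝ R
  let K : MaximalSpectrum R → Type _ := fun I => R ⧸ I.asIdeal
  let P : MaximalSpectrum R → Prop := fun I => Nonempty (K I ≃ₐ[ℝ] ℂ)
  have hnot : ∀ I : {I // ¬ P I}, Nonempty (K I.1 ≃ₐ[ℝ] ℝ) := fun I => by
    let _ : Field (K I.1) := Ideal.Quotient.field _
    have : Algebra.IsAlgebraic ℝ (K I.1) := Algebra.IsAlgebraic.of_finite _ _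
    exact (Real.nonempty_algEquiv_or (K I.1)).resolve_right I.2
  have e1 : ∀ I : {I // P I}, K I.1 ≃ₐ[ℝ] ℂ := fun I => Classical.choice I.2
  have e2 : ∀ I : {I // ¬ P I}, K I.1 ≃ₐ[ℝ] ℝ := fun I => Classical.choice (hnot I)
  have : Fintype (MaximalSpectrum R) := Fintype.ofFinite _
  refine ⟨Fintype.card {I // P I}, Fintype.card {I // ¬ P I}, ⟨AlgEquiv.symm ?_⟩⟩
  let split : (∀ I, K I) ≃ₐ[ℝ] (∀ I : {I // P I}, K I.1) × (∀ I : {I // ¬ P I}, K I.1) :=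
    AlgEquiv.ofRingEquiv (f := RingEquiv.mk (Equiv.piEquivPiSubtypeProd P K) (fun _ _ => rfl) (fun _ _ => rfl)) (fun _ => rfl)
  refine ((IsArtinianRing.equivPi R).restrictScalars ℝ).trans (split.trans (AlgEquiv.prodCongr ?_ ?_))
  · exact (AlgEquiv.piCongrRight e1).trans (AlgEquiv.piCongrLeft ℝ (fun _ => ℂ) (Fintype.equivFin _))
  · exact (AlgEquiv.piCongrRight e2).trans (AlgEquiv.piCongrLeft ℝ (fun _ => ℝ) (Fintype.equivFin _))

end ReducedAlgebra

/-! ### Regular representations as matrix algebras -/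

section MulMatrix

variable {n : ℕ} {A : Type*} [CommRing A] [Algebra ℝ A]

/-- The matrix of the multiplication by an element of the commutative algebra `A`, with respect to
a linear identification of `A` with `ℝⁿ`. -/
noncomputable def mulMatrix (φ : A ≃ₗ[ℝ] (Fin n → ℝ)) : A →ₐ[ℝ] Matrix (Fin n) (Fin n) ℝ :=
  (LinearMap.toMatrixAlgEquiv' (R := ℝ)).toAlgHom.comp
    ((φ.conjAlgEquiv ℝ).toAlgHom.comp (Algebra.lmul ℝ A))

theorem mulMatrix_mulVec (φ : A ≃ₗ[ℝ] (Fin n → ℝ)) (a x : A) :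
    (mulMatrix φ a).mulVec (φ x) = φ (a * x) := by
  rw [show mulMatrix φ a = LinearMap.toMatrix' (φ.conj (LinearMap.mul ℝ A a)) from rfl,
    LinearMap.toMatrix'_mulVec]
  simp [LinearEquiv.conj_apply]

theorem matrix_ext_mulVec (φ : A ≃ₗ[ℝ] (Fin n → ℝ)) {X Y : Matrix (Fin n) (Fin n) ℝ}
    (h : ∀ x, X.mulVec (φ x) = Y.mulVec (φ x)) : X = Y :=
  Matrix.mulVec_injective (funext fun w => by simpa using h (φ.symm w))

theorem mulMatrix_injective (φ : A ≃ₗ[ℝ] (Fin n → ℝ)) : Function.Injective (mulMatrix φ) := by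
  intro a b hab
  have := congrArg (fun X => X.mulVec (φ 1)) hab
  simpa [mulMatrix_mulVec] using this

/-- The orbit map of a vector with zero annihilator is injective; it is onto by a dimension count,
or because the image of `R` contains its commutant. It then identifies `R` with `ℝⁿ` and the action
with multiplication. -/
theorem exists_range_mulMatrix_eq {R : Type*} [CommRing R] [Algebra ℝ R] [FiniteDimensional ℝ R]
    [IsReduced R] (ρ : R →ₐ[ℝ] Matrix (Fin n) (Fin n) ℝ) (hρ : Function.Injective ρ)
    (h : finrank ℝ R = n ∨ ∀ X, (∀ r, Commute X (ρ r)) → X ∈ ρ.range) :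
    ∃ (p q : ℕ) (φ : ((Fin p → ℂ) × (Fin q → ℝ)) ≃ₗ[ℝ] (Fin n → ℝ)),
      ρ.range = (mulMatrix φ).range := by
  have : IsArtinianRing R := IsArtinianRing.of_finite ℝ R
  let τ : R →ₐ[ℝ] Module.End ℝ (Fin n → ℝ) := (Matrix.toLinAlgEquiv' (R := ℝ)).toAlgHom.comp ρ
  let _ : Module R (Fin n → ℝ) := Module.compHom _ τ.toRingHom
  have hsmul : ∀ (r : R) (x : Fin n → ℝ), r • x = (ρ r).mulVec x := fun r x => rfl
  have : FaithfulSMul R (Fin n → ℝ) := ⟨fun {a b} hab => hρ (Matrix.mulVec_injective (funext hab))⟩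
  obtain ⟨v, hv⟩ := exists_forall_smul_eq_zero_imp (R := R) (V := Fin n → ℝ)
  let ev : R →ₗ[ℝ] (Fin n → ℝ) :=
    { toFun := fun r => r • v
      map_add' := fun a b => add_smul a b v
      map_smul' := fun c a => by
        rw [hsmul, hsmul, map_smul, Matrix.smul_mulVec]; rfl }
  have hinj : Function.Injective ev := (injective_iff_map_eq_zero ev).mpr hv
  have hev : Function.Bijective ev := by
    rcases h with h | h
    · exact ⟨hinj, (LinearMap.injective_iff_surjective_of_finrank_eq_finrank
        (by simpa using h)).mp hinj⟩
    · refine bijective_smul_of_forall_endomorphism (fun f => ?_) hv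
      let g : (Fin n → ℝ) →ₗ[ℝ] (Fin n → ℝ) :=
        { toFun := f
          map_add' := f.map_add
          map_smul' := fun c x => by
            have : c • x = algebraMap ℝ R c • x := by
              rw [hsmul, AlgHom.commutes, Algebra.algebraMap_eq_smul_one, Matrix.smul_mulVec,
                Matrix.one_mulVec]
            have h2 : c • f x = algebraMap ℝ R c • f x := by
              rw [hsmul, AlgHom.commutes, Algebra.algebraMap_eq_smul_one, Matrix.smul_mulVec,
                Matrix.one_mulVec]
            rw [this, map_smul, ← h2]; rfl }
      have hg : ∀ x, (LinearMap.toMatrix' g).mulVec x = f x := fun x => by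
        rw [LinearMap.toMatrix'_mulVec]; rfl
      obtain ⟨r, hr⟩ := h (LinearMap.toMatrix' g) fun r => by
        refine Matrix.mulVec_injective (funext fun x => ?_)
        rw [← Matrix.mulVec_mulVec, ← Matrix.mulVec_mulVec, hg, hg, ← hsmul, ← hsmul, map_smul]
      refine ⟨r, fun x => ?_⟩
      rw [hsmul, ← hg]
      exact congrArg (fun X => Matrix.mulVec X x) hr.symm
  obtain ⟨p, q, ⟨e⟩⟩ := exists_algEquiv_pi_complex_prod_pi_real R
  let φ : ((Fin p → ℂ) × (Fin q → ℝ)) ≃ₗ[ℝ] (Fin n → ℝ) :=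
    e.toLinearEquiv.trans (LinearEquiv.ofBijective ev hev)
  have hφ : ∀ x, φ x = (ρ (e x)).mulVec v := fun x => rfl
  have key : ∀ a, ρ (e a) = mulMatrix φ a := fun a => matrix_ext_mulVec φ fun x => by
    rw [mulMatrix_mulVec, hφ, hφ, map_mul, map_mul, Matrix.mulVec_mulVec]
  refine ⟨p, q, φ, le_antisymm ?_ ?_⟩
  · rintro _ ⟨r, rfl⟩
    exact ⟨e.symm r, by simp [← key]⟩
  · rintro _ ⟨a, rfl⟩
    exact ⟨e a, key a⟩

end MulMatrix

/-! ### A separable generator of `ℂᵖ × ℝᵠ` -/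

section SeparableGenerator

open Polynomial

theorem finrank_quotient_ker_aeval {R : Type*} [Ring R] [Algebra ℝ R] (x : R) :
    finrank ℝ (ℝ[X] ⧸ RingHom.ker (aeval (R := ℝ) x)) = (minpoly ℝ x).natDegree := by
  have h := minpoly.ker_aeval_eq_span_minpoly ℝ x
  rw [← finrank_quotient_span_eq_natDegree (f := minpoly ℝ x)]
  exact (Ideal.quotientEquivAlgOfEq ℝ h).toLinearEquiv.finrank_eq

theorem finrank_adjoin_singleton {R : Type*} [Ring R] [Algebra ℝ R] (x : R) :
    finrank ℝ (Algebra.adjoin ℝ {x}) = (minpoly ℝ x).natDegree := by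
  rw [Algebra.adjoin_singleton_eq_range_aeval, ← finrank_quotient_ker_aeval]
  exact ((aeval (R := ℝ) x).toLinearMap.quotKerEquivRange).finrank_eq.symm

theorem isReduced_quotient_ker_aeval {R : Type*} [Ring R] [Algebra ℝ R] {x : R}
    (h : (minpoly ℝ x).Separable) : IsReduced (ℝ[X] ⧸ RingHom.ker (aeval (R := ℝ) x)) := by
  rw [← Ideal.isRadical_iff_quotient_reduced, minpoly.ker_aeval_eq_span_minpoly]
  exact isRadical_iff_span_singleton.mp h.squarefree.isRadical

theorem hasDistinctEigenvalues_iff_separable {n : ℕ} (M : Matrix (Fin n) (Fin n) ℝ) :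
    HasDistinctEigenvalues M ↔ M.charpoly.Separable := by
  have hs : spectrum ℂ (M.map (algebraMap ℝ ℂ)) = M.charpoly.rootSet ℂ := by
    ext z
    rw [Matrix.mem_spectrum_iff_isRoot_charpoly, Matrix.charpoly_map, mem_rootSet',
      IsRoot, eval_map_algebraMap]
    exact ⟨fun h => ⟨by rw [← Matrix.charpoly_map]; exact (Matrix.charpoly_monic _).ne_zero, h⟩,
      fun h => h.2⟩
  have h1 := card_rootSet_eq_natDegree_iff_of_splits (K := ℂ) (Matrix.charpoly_monic M).ne_zero
    (IsAlgClosed.splits _)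
  rw [HasDistinctEigenvalues, hs, ← h1, Matrix.charpoly_natDegree_eq_dim, Fintype.card_fin,
    Set.ncard_eq_toFinset_card', Set.toFinset_card]

/-- The algebra homomorphism to `ℂ` given by a complex factor, its conjugate, or a real factor. -/
noncomputable def character {p q : ℕ} :
    Fin p ⊕ Fin p ⊕ Fin q → (((Fin p → ℂ) × (Fin q → ℝ)) →ₐ[ℝ] ℂ)
  | .inl j => (Pi.evalAlgHom ℝ (fun _ : Fin p => ℂ) j).comp (AlgHom.fst ℝ _ _)
  | .inr (.inl j) => (Complex.conjAe : ℂ →ₐ[ℝ] ℂ).comp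
      ((Pi.evalAlgHom ℝ (fun _ : Fin p => ℂ) j).comp (AlgHom.fst ℝ _ _))
  | .inr (.inr k) => Complex.ofRealAm.comp
      ((Pi.evalAlgHom ℝ (fun _ : Fin q => ℝ) k).comp (AlgHom.snd ℝ _ _))

/-- An element of `ℂᵖ × ℝᵠ` whose components are pairwise not conjugate. -/
noncomputable def distinctElement (p q : ℕ) : (Fin p → ℂ) × (Fin q → ℝ) :=
  (fun j => ⟨0, (j : ℕ) + 1⟩, fun k => (k : ℕ))

/-- The complex components are `(j + 1) i`; the shift by one keeps them off the real axis, away from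
their conjugates and from the real components. -/
theorem character_distinctElement_injective (p q : ℕ) :
    Function.Injective fun i => character i (distinctElement p q) := by
  rintro (i | i | i) (j | j | j) h
  all_goals
    have hre := congrArg Complex.re h
    have him := congrArg Complex.im h
    simp [character, distinctElement] at hre him
  · exact congrArg _ (Fin.ext him)
  · linarith [(i : ℕ).cast_nonneg (α := ℝ), (j : ℕ).cast_nonneg (α := ℝ)]
  · linarith [(i : ℕ).cast_nonneg (α := ℝ)]
  · linarith [(i : ℕ).cast_nonneg (α := ℝ), (j : ℕ).cast_nonneg (α := ℝ)]
  · exact congrArg _ (congrArg _ (Fin.ext him))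
  · linarith [(i : ℕ).cast_nonneg (α := ℝ)]
  · linarith [(j : ℕ).cast_nonneg (α := ℝ)]
  · linarith [(j : ℕ).cast_nonneg (α := ℝ)]
  · exact congrArg _ (congrArg _ (Fin.ext hre))

theorem finrank_pi_complex_prod_pi_real (p q : ℕ) :
    finrank ℝ ((Fin p → ℂ) × (Fin q → ℝ)) = 2 * p + q := by
  simp [finrank_prod, finrank_pi_fintype, mul_comm]

/-- The `2p + q` distinct character values are roots of the minimal polynomial, whose degree is at
most the dimension `2p + q`. Equality everywhere gives separability and generation. -/
theorem minpoly_distinctElement (p q : ℕ) :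
    (minpoly ℝ (distinctElement p q)).natDegree = 2 * p + q ∧
      (minpoly ℝ (distinctElement p q)).Separable ∧
      Algebra.adjoin ℝ {distinctElement p q} = ⊤ := by
  set a := distinctElement p q
  have hint : IsIntegral ℝ a := Algebra.IsIntegral.isIntegral a
  have hne : minpoly ℝ a ≠ 0 := minpoly.ne_zero hint
  let f : Fin p ⊕ Fin p ⊕ Fin q → (minpoly ℝ a).rootSet ℂ := fun i =>
    ⟨character i a, by
      rw [mem_rootSet]
      exact ⟨hne, by rw [aeval_algHom_apply, minpoly.aeval, map_zero]⟩⟩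
  have hf : Function.Injective f := fun i j hij =>
    character_distinctElement_injective p q (congrArg Subtype.val hij)
  have h1 : 2 * p + q ≤ Fintype.card ((minpoly ℝ a).rootSet ℂ) := by
    have := Fintype.card_le_of_injective f hf
    simp only [Fintype.card_sum, Fintype.card_fin] at this
    omega
  have h2 : Fintype.card ((minpoly ℝ a).rootSet ℂ) ≤ (minpoly ℝ a).natDegree :=
    (Set.ncard_eq_toFinset_card' ((minpoly ℝ a).rootSet ℂ)).trans (Set.toFinset_card _) ▸
      ncard_rootSet_le (minpoly ℝ a) ℂ
  have h3 : (minpoly ℝ a).natDegree ≤ 2 * p + q := by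
    rw [← finrank_adjoin_singleton, ← finrank_pi_complex_prod_pi_real]
    exact Submodule.finrank_le (Subalgebra.toSubmodule (Algebra.adjoin ℝ {a}))
  refine ⟨by omega, ?_, ?_⟩
  · rw [← card_rootSet_eq_natDegree_iff_of_splits (K := ℂ) hne (IsAlgClosed.splits _)]
    omega
  · apply Subalgebra.toSubmodule_injective
    rw [Algebra.top_toSubmodule]
    apply Submodule.eq_top_of_finrank_eq
    rw [finrank_pi_complex_prod_pi_real]
    exact (finrank_adjoin_singleton a).trans (by omega)

/-- For the generator `a` with minimal polynomial `m`, `0 = D (m(a)) = m'(a) D a`, and separability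
makes `m'(a)` a unit. -/
theorem derivation_pi_complex_prod_pi_real_eq_zero {p q : ℕ}
    (D : Derivation ℝ ((Fin p → ℂ) × (Fin q → ℝ)) ((Fin p → ℂ) × (Fin q → ℝ))) : D = 0 := by
  obtain ⟨-, hsep, htop⟩ := minpoly_distinctElement p q
  set a := distinctElement p q
  have h1 : aeval a (derivative (minpoly ℝ a)) • D a = 0 := by
    rw [← D.map_aeval, minpoly.aeval, map_zero]
  obtain ⟨u, v, huv⟩ := hsep
  have h2 := congrArg (aeval a) huv
  rw [map_add, map_mul, map_mul, minpoly.aeval, mul_zero, zero_add, map_one] at h2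
  have h3 : D a = 0 := by
    rw [← one_smul ((Fin p → ℂ) × (Fin q → ℝ)) (D a), ← h2, mul_smul, h1, smul_zero]
  refine Derivation.ext_of_adjoin_eq_top {a} htop ?_
  rintro _ rfl
  simpa using h3

end SeparableGenerator

/-! ### The decomposition of matrices into scalar and traceless parts -/

section ScalarsPlus

variable {n : ℕ} {h : LieSubalgebra ℝ (slR n)}

theorem mem_scalarsPlus {X : Matrix (Fin n) (Fin n) ℝ} :
    X ∈ scalarsPlus h ↔ ∃ c : ℝ, ∃ y ∈ h, X = c • 1 + (y : Matrix (Fin n) (Fin n) ℝ) := by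
  change X ∈ Submodule.span ℝ {1} ⊔ (h.map (slR n).incl).toSubmodule ↔ _
  rw [Submodule.mem_sup]
  constructor
  · rintro ⟨a, ha, b, ⟨y, hy, rfl⟩, rfl⟩
    obtain ⟨c, rfl⟩ := Submodule.mem_span_singleton.mp ha
    exact ⟨c, y, hy, rfl⟩
  · rintro ⟨c, y, hy, rfl⟩
    exact ⟨_, Submodule.mem_span_singleton.mpr ⟨c, rfl⟩, _, ⟨y, hy, rfl⟩, rfl⟩

theorem coe_mem_scalarsPlus {y : slR n} (hy : y ∈ h) :
    (y : Matrix (Fin n) (Fin n) ℝ) ∈ scalarsPlus h :=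
  mem_scalarsPlus.mpr ⟨0, y, hy, by simp⟩

theorem one_mem_scalarsPlus : (1 : Matrix (Fin n) (Fin n) ℝ) ∈ scalarsPlus h :=
  mem_scalarsPlus.mpr ⟨1, 0, h.zero_mem, by simp⟩

theorem mem_slR {X : Matrix (Fin n) (Fin n) ℝ} : X ∈ slR n ↔ X.trace = 0 :=
  Iff.rfl

theorem trace_coe_slR (x : slR n) : (x : Matrix (Fin n) (Fin n) ℝ).trace = 0 :=
  mem_slR.mp x.2

theorem mem_of_coe_mem_scalarsPlus (hn : 1 ≤ n) {x : slR n}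
    (hx : (x : Matrix (Fin n) (Fin n) ℝ) ∈ scalarsPlus h) : x ∈ h := by
  obtain ⟨c, y, hy, hxy⟩ := mem_scalarsPlus.mp hx
  have h1 := congrArg Matrix.trace hxy
  rw [Matrix.trace_add, Matrix.trace_smul, trace_coe_slR, trace_coe_slR, Matrix.trace_one,
    Fintype.card_fin, add_zero, smul_eq_mul, eq_comm, mul_eq_zero] at h1
  have hn0 : (n : ℝ) ≠ 0 := by exact_mod_cast Nat.one_le_iff_ne_zero.mp hn
  rw [h1.resolve_right hn0, zero_smul, zero_add] at hxy
  rwa [Subtype.ext hxy]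

theorem exists_smul_one_add_slR (hn : 1 ≤ n) (X : Matrix (Fin n) (Fin n) ℝ) :
    ∃ (c : ℝ) (x : slR n), X = c • 1 + (x : Matrix (Fin n) (Fin n) ℝ) := by
  have hn0 : (n : ℝ) ≠ 0 := by exact_mod_cast Nat.one_le_iff_ne_zero.mp hn
  refine ⟨X.trace / n, ⟨X - (X.trace / n) • 1, ?_⟩, by simp⟩
  rw [mem_slR, Matrix.trace_sub, Matrix.trace_smul, Matrix.trace_one, Fintype.card_fin,
    smul_eq_mul, div_mul_cancel₀ _ hn0, sub_self]

theorem coe_bracket_slR (x y : slR n) : ((⁅x, y⁆ : slR n) : Matrix (Fin n) (Fin n) ℝ) =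
    (x : Matrix (Fin n) (Fin n) ℝ) * y - (y : Matrix (Fin n) (Fin n) ℝ) * x :=
  rfl

theorem commute_of_mem [IsLieAbelian h] {x y : slR n} (hx : x ∈ h) (hy : y ∈ h) :
    Commute (x : Matrix (Fin n) (Fin n) ℝ) y := by
  have h1 : ⁅x, y⁆ = 0 := congrArg Subtype.val (trivial_lie_zero h h ⟨x, hx⟩ ⟨y, hy⟩)
  have h2 := congrArg (Subtype.val : slR n → Matrix (Fin n) (Fin n) ℝ) h1
  rw [coe_bracket_slR] at h2
  exact sub_eq_zero.mp h2

theorem commute_of_mem_scalarsPlus [IsLieAbelian h] {X Y : Matrix (Fin n) (Fin n) ℝ}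
    (hX : X ∈ scalarsPlus h) (hY : Y ∈ scalarsPlus h) : Commute X Y := by
  obtain ⟨c, x, hx, rfl⟩ := mem_scalarsPlus.mp hX
  obtain ⟨d, y, hy, rfl⟩ := mem_scalarsPlus.mp hY
  exact ((Commute.one_left _).smul_left c).add_left
    (((Commute.one_right _).smul_right d).add_right (commute_of_mem hx hy))

/-- `ℝ I ⊕ h` is the algebra of multiplications of an algebra `ℂᵖ × ℝᵠ`, for some identification of
the latter with `ℝⁿ`. -/
def IsMultiplicationAlgebra (h : LieSubalgebra ℝ (slR n)) : Prop :=
  ∃ (p q : ℕ) (φ : ((Fin p → ℂ) × (Fin q → ℝ)) ≃ₗ[ℝ] (Fin n → ℝ)),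
    (scalarsPlus h).toSubmodule = Subalgebra.toSubmodule (mulMatrix φ).range

end ScalarsPlus

/-! ### Cartan subalgebras and multiplication algebras -/

section Cartan

variable {n : ℕ} {h : LieSubalgebra ℝ (slR n)}

theorem mem_scalarsPlus_of_forall_commute (hn : 1 ≤ n) (hC : h.IsCartanSubalgebra)
    {X : Matrix (Fin n) (Fin n) ℝ} (hX : ∀ Y ∈ scalarsPlus h, Commute X Y) :
    X ∈ scalarsPlus h := by
  obtain ⟨c, x, rfl⟩ := exists_smul_one_add_slR hn X
  refine mem_scalarsPlus.mpr ⟨c, x, ?_, rfl⟩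
  rw [← hC.self_normalizing, LieSubalgebra.mem_normalizer_iff]
  intro y hy
  have h1 : Commute (x : Matrix (Fin n) (Fin n) ℝ) y := by
    have := (hX _ (coe_mem_scalarsPlus hy)).sub_left
      ((Commute.one_left (y : Matrix (Fin n) (Fin n) ℝ)).smul_left c)
    rwa [add_sub_cancel_left] at this
  have h2 : ⁅x, y⁆ = 0 := Subtype.ext (by rw [coe_bracket_slR, h1.eq, sub_self]; rfl)
  rw [h2]
  exact h.zero_mem

/-- Fitting's decomposition under `h` splits `sl(n)` into the zero root space, which is `h`, and a
complement. Invariance of the trace form makes `X` orthogonal to the complement; for `y ∈ h` the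
product `X y` of commuting factors is nilpotent, hence traceless. Nondegeneracy on all matrices
concludes. -/
theorem eq_zero_of_isNilpotent_of_mem_scalarsPlus [IsLieAbelian h] (hn : 1 ≤ n)
    (hC : h.IsCartanSubalgebra) {X : Matrix (Fin n) (Fin n) ℝ} (hX : X ∈ scalarsPlus h)
    (hnil : IsNilpotent X) : X = 0 := by
  have htr : X.trace = 0 := (Matrix.isNilpotent_trace_of_isNilpotent hnil).eq_zero
  let x : slR n := ⟨X, htr⟩
  have hx : x ∈ h := mem_of_coe_mem_scalarsPlus hn hX
  let F : LinearMap.BilinForm ℝ (slR n) :=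
    LinearMap.mk₂ ℝ (fun a b => ((a : Matrix (Fin n) (Fin n) ℝ) * b).trace)
      (fun a b c => by simp [add_mul]) (fun c a b => by simp)
      (fun a b c => by simp [mul_add]) (fun c a b => by simp)
  have hF : ∀ a b : slR n, F a b = ((a : Matrix (Fin n) (Fin n) ℝ) * b).trace := fun _ _ => rfl
  have hinv : ∀ (a : h) (m k : slR n), F ⁅a, m⁆ k = - F m ⁅a, k⁆ := fun a m k => by
    rw [LieSubalgebra.coe_bracket_of_module, LieSubalgebra.coe_bracket_of_module, hF, hF,
      coe_bracket_slR, coe_bracket_slR, sub_mul, mul_sub, Matrix.trace_sub, Matrix.trace_sub,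
      mul_assoc, mul_assoc, Matrix.trace_mul_comm (a : Matrix (Fin n) (Fin n) ℝ), neg_sub,
      mul_assoc]
  have hzero : ∀ y : slR n, F x y = 0 := fun y => by
    have hcod := (LieModule.isCompl_genWeightSpace_zero_posFittingComp ℝ h (slR n)).codisjoint
    have hy : y ∈ LieModule.genWeightSpace (slR n) (0 : h → ℝ) ⊔
        LieModule.posFittingComp ℝ h (slR n) := by
      rw [codisjoint_iff.mp hcod]; trivial
    obtain ⟨y₀, hy₀, y₁, hy₁, rfl⟩ := LieSubmodule.mem_sup _ _ _ |>.mp hy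
    have hx' : x ∈ LieModule.genWeightSpace (slR n) (0 : h → ℝ) :=
      toLieSubmodule_le_rootSpace_zero ℝ (slR n) h hx
    rw [map_add, LieModule.eq_zero_of_mem_genWeightSpace_mem_posFitting ℝ h (slR n) hinv hx' hy₁,
      add_zero, hF]
    have hy₀' : y₀ ∈ h := by
      have : y₀ ∈ rootSpace h (0 : h → ℝ) := hy₀
      rwa [rootSpace_zero_eq] at this
    exact (Matrix.isNilpotent_trace_of_isNilpotent
      ((commute_of_mem hx hy₀').isNilpotent_mul_right hnil)).eq_zero
  refine Matrix.ext_iff_trace_mul_right.mpr fun Y => ?_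
  obtain ⟨c, y, rfl⟩ := exists_smul_one_add_slR hn Y
  have := hzero y
  rw [hF] at this
  simp [mul_add, htr, this, x]

theorem isMultiplicationAlgebra_of_isCartanSubalgebra [IsLieAbelian h] (hn : 1 ≤ n)
    (hC : h.IsCartanSubalgebra) : IsMultiplicationAlgebra h := by
  let B : Subalgebra ℝ (Matrix (Fin n) (Fin n) ℝ) :=
    -- Closed under products: `X Y` commutes with `B`, which contains its centralizer.
    (scalarsPlus h).toSubmodule.toSubalgebra one_mem_scalarsPlus fun X Y hX hY =>
      mem_scalarsPlus_of_forall_commute hn hC fun Z hZ =>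
        (commute_of_mem_scalarsPlus hX hZ).mul_left (commute_of_mem_scalarsPlus hY hZ)
  have hB : ∀ X, X ∈ B ↔ X ∈ scalarsPlus h := fun X => Iff.rfl
  let _ : CommRing B := { (inferInstance : Ring B) with
    mul_comm := fun X Y => Subtype.ext (commute_of_mem_scalarsPlus X.2 Y.2).eq }
  have : IsReduced B := ⟨fun X hX => Subtype.ext
    (eq_zero_of_isNilpotent_of_mem_scalarsPlus hn hC X.2 (hX.map B.val))⟩
  obtain ⟨p, q, φ, hφ⟩ := exists_range_mulMatrix_eq B.val Subtype.val_injective <| .inr fun X hX => by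
    rw [Subalgebra.range_val, hB]
    exact mem_scalarsPlus_of_forall_commute hn hC fun Y hY => hX ⟨Y, hY⟩
  refine ⟨p, q, φ, ?_⟩
  rw [← hφ, Subalgebra.range_val]
  rfl

theorem isCartanSubalgebra_of_isMultiplicationAlgebra [IsLieAbelian h] (hn : 1 ≤ n)
    (hD : IsMultiplicationAlgebra h) : h.IsCartanSubalgebra := by
  obtain ⟨p, q, φ, hφ⟩ := hD
  have hmem : ∀ X, X ∈ scalarsPlus h ↔ ∃ a, mulMatrix φ a = X := fun X => by
    rw [← LieSubalgebra.mem_toSubmodule, hφ]; rfl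
  refine ⟨inferInstance, le_antisymm (fun x hx => ?_) (LieSubalgebra.le_normalizer _)⟩
  rw [LieSubalgebra.mem_normalizer_iff] at hx
  let X : Matrix (Fin n) (Fin n) ℝ := x
  have hXdef : X = x := rfl
  have hbr : ∀ a, ∃ d, mulMatrix φ d = X * mulMatrix φ a - mulMatrix φ a * X := fun a => by
    obtain ⟨c, y, hy, hay⟩ := mem_scalarsPlus.mp ((hmem _).mpr ⟨a, rfl⟩)
    obtain ⟨d, hd⟩ := (hmem _).mp (coe_mem_scalarsPlus (hx y hy))
    refine ⟨d, ?_⟩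
    rw [hd, hay, coe_bracket_slR, mul_add, add_mul]
    simp [hXdef]
  choose δ hδ using hbr
  have hinj := mulMatrix_injective φ
  -- Bracketing with `X` preserves the multiplication algebra, so it is a derivation of `ℂᵖ × ℝᵠ`.
  let D : Derivation ℝ ((Fin p → ℂ) × (Fin q → ℝ)) ((Fin p → ℂ) × (Fin q → ℝ)) :=
    Derivation.mk'
      { toFun := δ
        map_add' := fun a b => hinj (by
          simp only [map_add, hδ, mul_add, add_mul]; abel)
        map_smul' := fun c a => hinj (by
          simp only [map_smul, hδ, mul_smul_comm, smul_mul_assoc, smul_sub, RingHom.id_apply]) }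
      fun a b => hinj (by
        simp only [LinearMap.coe_mk, AddHom.coe_mk, map_add, map_mul, hδ, smul_eq_mul]
        have hc : mulMatrix φ b * (X * mulMatrix φ a - mulMatrix φ a * X) =
            (X * mulMatrix φ a - mulMatrix φ a * X) * mulMatrix φ b := by
          rw [← hδ, ← map_mul, ← map_mul, mul_comm]
        rw [hc]
        noncomm_ring)
  have hcomm : ∀ a, X * mulMatrix φ a = mulMatrix φ a * X := fun a => by
    have h0 : δ a = 0 :=
      DFunLike.congr_fun (derivation_pi_complex_prod_pi_real_eq_zero D) a
    rw [← sub_eq_zero, ← hδ, h0, map_zero]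
  -- An operator commuting with all multiplications is multiplication by its value at `1`.
  refine mem_of_coe_mem_scalarsPlus hn ((hmem _).mpr ⟨φ.symm (X.mulVec (φ 1)), ?_⟩)
  refine matrix_ext_mulVec φ fun a => ?_
  have h1 : φ a = (mulMatrix φ a).mulVec (φ 1) := by rw [mulMatrix_mulVec, mul_one]
  rw [mulMatrix_mulVec, mul_comm, ← mulMatrix_mulVec, φ.apply_symm_apply, Matrix.mulVec_mulVec,
    ← hcomm, ← Matrix.mulVec_mulVec, ← h1]

end Cartan

/-! ### Polynomial algebras of nonderogatory matrices -/

section Nonderogatory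

open Polynomial

variable {n : ℕ} {h : LieSubalgebra ℝ (slR n)}

theorem isMultiplicationAlgebra_of_isNonderogatory {M : Matrix (Fin n) (Fin n) ℝ}
    (hM : IsNonderogatory M) (hM' : HasDistinctEigenvalues M)
    (hh : (scalarsPlus h).toSubmodule = Subalgebra.toSubmodule (Algebra.adjoin ℝ {M})) :
    IsMultiplicationAlgebra h := by
  have hsep : (minpoly ℝ M).Separable := by
    rwa [← hM, ← hasDistinctEigenvalues_iff_separable]
  have := isReduced_quotient_ker_aeval hsep
  have hdim : finrank ℝ (ℝ[X] ⧸ RingHom.ker (aeval (R := ℝ) M)) = n := by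
    rw [finrank_quotient_ker_aeval, ← hM, Matrix.charpoly_natDegree_eq_dim, Fintype.card_fin]
  have hinj := Ideal.kerLiftAlg_injective (aeval (R := ℝ) M)
  have : FiniteDimensional ℝ (ℝ[X] ⧸ RingHom.ker (aeval (R := ℝ) M)) :=
    FiniteDimensional.of_injective (Ideal.kerLiftAlg (aeval (R := ℝ) M)).toLinearMap hinj
  obtain ⟨p, q, φ, hφ⟩ := exists_range_mulMatrix_eq _ hinj (.inl hdim)
  refine ⟨p, q, φ, ?_⟩
  rw [hh, ← hφ, Algebra.adjoin_singleton_eq_range_aeval]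
  congr 1
  ext X
  constructor
  · rintro ⟨f, rfl⟩
    exact ⟨Ideal.Quotient.mk _ f, rfl⟩
  · rintro ⟨f, rfl⟩
    obtain ⟨f, rfl⟩ := Ideal.Quotient.mk_surjective f
    exact ⟨f, rfl⟩

theorem exists_isNonderogatory_of_isMultiplicationAlgebra (hD : IsMultiplicationAlgebra h) :
    ∃ M : Matrix (Fin n) (Fin n) ℝ, IsNonderogatory M ∧ HasDistinctEigenvalues M ∧
      (scalarsPlus h).toSubmodule = Subalgebra.toSubmodule (Algebra.adjoin ℝ {M}) := by
  obtain ⟨p, q, φ, hφ⟩ := hD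
  obtain ⟨hdeg, hsep, htop⟩ := minpoly_distinctElement p q
  set M := mulMatrix φ (distinctElement p q)
  have hmin : minpoly ℝ M = minpoly ℝ (distinctElement p q) :=
    minpoly.algHom_eq _ (mulMatrix_injective φ) _
  have hn : 2 * p + q = n := by
    rw [← finrank_pi_complex_prod_pi_real, φ.finrank_eq]; simp
  have hnon : IsNonderogatory M := by
    refine Polynomial.eq_of_monic_of_dvd_of_natDegree_le
      (minpoly.monic (Algebra.IsIntegral.isIntegral M)) M.charpoly_monic
      (Matrix.minpoly_dvd_charpoly M) ?_
    rw [hmin, hdeg, Matrix.charpoly_natDegree_eq_dim, Fintype.card_fin, hn]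
  refine ⟨M, hnon, ?_, ?_⟩
  · rwa [hasDistinctEigenvalues_iff_separable, hnon, hmin]
  · rw [hφ, ← Algebra.map_top, ← htop, AlgHom.map_adjoin, Set.image_singleton]

end Nonderogatory

/-! ### Direct sums of `aff` as `A ⋉ A` -/

section Affine

/-- The coordinates `(z₁, z₂)` on `aff(𝕂)`. -/
noncomputable def affCoords (𝕂 : Type) [RCLike 𝕂] : aff 𝕂 ≃ₗ[ℝ] 𝕂 × 𝕂 where
  toFun X := (X.1 0 0, X.1 0 1)
  map_add' _ _ := rfl
  map_smul' _ _ := rfl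
  invFun z := ⟨!![z.1, z.2; 0, 0], by constructor <;> simp⟩
  left_inv X := by
    obtain ⟨X, h0, h1⟩ := X
    ext i j
    fin_cases i <;> fin_cases j <;> simp [h0, h1]
  right_inv z := by simp

theorem affCoords_lie {𝕂 : Type} [RCLike 𝕂] (X Y : aff 𝕂) :
    affCoords 𝕂 ⁅X, Y⁆ = (0, (affCoords 𝕂 X).1 * (affCoords 𝕂 Y).2 -
      (affCoords 𝕂 Y).1 * (affCoords 𝕂 X).2) := by
  obtain ⟨X, h0, h1⟩ := X
  obtain ⟨Y, h2, h3⟩ := Y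
  change ((X * Y - Y * X) 0 0, (X * Y - Y * X) 0 1) = (0, X 0 0 * Y 0 1 - Y 0 0 * X 0 1)
  simp only [Matrix.sub_apply, Matrix.mul_apply, Fin.sum_univ_two, h0, h1, h2, h3, mul_zero,
    add_zero, Prod.mk.injEq, and_true]
  ring

/-- The coordinates on a direct sum of copies of `aff(𝕂)`. -/
noncomputable def affSumCoords (𝕂 : Type) [RCLike 𝕂] (m : ℕ) :
    (DirectSum (Fin m) fun _ => aff 𝕂) ≃ₗ[ℝ] (Fin m → 𝕂) × (Fin m → 𝕂) :=
  (DirectSum.linearEquivFunOnFintype ℝ (Fin m) fun _ => aff 𝕂).trans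
    ((LinearEquiv.piCongrRight fun _ => affCoords 𝕂).trans
      { toFun := fun f => (fun i => (f i).1, fun i => (f i).2)
        map_add' := fun _ _ => rfl
        map_smul' := fun _ _ => rfl
        invFun := fun g i => (g.1 i, g.2 i)
        left_inv := fun _ => rfl
        right_inv := fun _ => rfl })

theorem affSumCoords_lie {𝕂 : Type} [RCLike 𝕂] {m : ℕ} (X Y : DirectSum (Fin m) fun _ => aff 𝕂) :
    affSumCoords 𝕂 m ⁅X, Y⁆ = (0, (affSumCoords 𝕂 m X).1 * (affSumCoords 𝕂 m Y).2 -
      (affSumCoords 𝕂 m Y).1 * (affSumCoords 𝕂 m X).2) := by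
  have h1 : ∀ Z i, (affSumCoords 𝕂 m Z).1 i = (affCoords 𝕂 (Z i)).1 := fun Z i => rfl
  have h2 : ∀ Z i, (affSumCoords 𝕂 m Z).2 i = (affCoords 𝕂 (Z i)).2 := fun Z i => rfl
  ext i <;> simp [h1, h2, DirectSum.bracket_apply, affCoords_lie]

/-- The coordinates on a direct sum of copies of `aff(ℂ)` and `aff(ℝ)`. -/
noncomputable def affProdCoords (p q : ℕ) :
    ((DirectSum (Fin p) fun _ => aff ℂ) × (DirectSum (Fin q) fun _ => aff ℝ)) ≃ₗ[ℝ]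
      ((Fin p → ℂ) × (Fin q → ℝ)) × ((Fin p → ℂ) × (Fin q → ℝ)) :=
  ((affSumCoords ℂ p).prodCongr (affSumCoords ℝ q)).trans (LinearEquiv.prodProdProdComm ℝ _ _ _ _)

theorem affProdCoords_lie {p q : ℕ}
    (X Y : (DirectSum (Fin p) fun _ => aff ℂ) × (DirectSum (Fin q) fun _ => aff ℝ)) :
    affProdCoords p q ⁅X, Y⁆ = (0, (affProdCoords p q X).1 * (affProdCoords p q Y).2 -
      (affProdCoords p q Y).1 * (affProdCoords p q X).2) := by
  have h : ∀ Z, affProdCoords p q Z = (((affSumCoords ℂ p Z.1).1, (affSumCoords ℝ q Z.2).1),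
      ((affSumCoords ℂ p Z.1).2, (affSumCoords ℝ q Z.2).2)) := fun Z => rfl
  have h1 : ⁅X, Y⁆.1 = ⁅X.1, Y.1⁆ := rfl
  have h2 : ⁅X, Y⁆.2 = ⁅X.2, Y.2⁆ := rfl
  simp only [h, h1, h2, affSumCoords_lie]
  rfl

end Affine

/-! ### The semidirect sum and its derived algebra -/

section Semidirect

variable {n : ℕ} {h : LieSubalgebra ℝ (slR n)}

theorem bracket_semidirect [IsLieAbelian h] (s t : semidirect (scalarsPlus h)) :
    ⁅s, t⁆ = ⟨(s.right : Matrix (Fin n) (Fin n) ℝ).mulVec t.left -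
      (t.right : Matrix (Fin n) (Fin n) ℝ).mulVec s.left, 0⟩ := by
  have h0 : ⁅s.right, t.right⁆ = 0 := Subtype.ext <| by
    rw [LieSubalgebra.coe_bracket, LieRing.of_associative_ring_bracket,
      (commute_of_mem_scalarsPlus s.right.2 t.right.2).eq, sub_self]
    rfl
  have h1 : ⁅s.left, t.left⁆ = 0 := by
    rw [LieRing.of_associative_ring_bracket, mul_comm, sub_self]
  rw [SemiDirectSum.lie_eq_mk, h0, h1, zero_add]
  rfl

theorem nonempty_lieEquiv_of_eq_range_mulMatrix [IsLieAbelian h] {p q : ℕ}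
    (φ : ((Fin p → ℂ) × (Fin q → ℝ)) ≃ₗ[ℝ] (Fin n → ℝ))
    (hφ : (scalarsPlus h).toSubmodule = Subalgebra.toSubmodule (mulMatrix φ).range) :
    Nonempty (semidirect (scalarsPlus h) ≃ₗ⁅ℝ⁆
      (DirectSum (Fin p) fun _ => aff ℂ) × (DirectSum (Fin q) fun _ => aff ℝ)) := by
  let ρ : ((Fin p → ℂ) × (Fin q → ℝ)) ≃ₗ[ℝ] scalarsPlus h :=
    (LinearEquiv.ofInjective (mulMatrix φ).toLinearMap (mulMatrix_injective φ)).trans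
      (LinearEquiv.ofEq _ _ hφ.symm)
  have hρ : ∀ a, (ρ a : Matrix (Fin n) (Fin n) ℝ) = mulMatrix φ a := fun a => rfl
  let e : (((Fin p → ℂ) × (Fin q → ℝ)) × ((Fin p → ℂ) × (Fin q → ℝ))) ≃ₗ[ℝ]
      semidirect (scalarsPlus h) :=
    (LinearEquiv.prodComm ℝ _ _).trans ((φ.prodCongr ρ).trans (SemiDirectSum.toProdl _).symm)
  have he : ∀ z, e z = ⟨φ z.2, ρ z.1⟩ := fun z => rfl
  let Ψ := (affProdCoords p q).trans e
  have hΨ : ∀ X Y, Ψ ⁅X, Y⁆ = ⁅Ψ X, Ψ Y⁆ := fun X Y => by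
    rw [bracket_semidirect]
    simp only [Ψ, LinearEquiv.trans_apply, affProdCoords_lie, he, hρ, mulMatrix_mulVec, map_sub,
      map_zero]
  exact ⟨LieEquiv.symm { Ψ with map_lie' := fun {X Y} => hΨ X Y }⟩

/-- The isomorphism matches the derived algebras, `ℝⁿ` on one side and `0 × A` on the other. Under
this identification, an element of `ℝ I ⊕ h` acts as multiplication by the first coordinate of its
image. -/
theorem isMultiplicationAlgebra_of_lieEquiv [IsLieAbelian h] {p q : ℕ}
    (Φ : semidirect (scalarsPlus h) ≃ₗ⁅ℝ⁆
      (DirectSum (Fin p) fun _ => aff ℂ) × (DirectSum (Fin q) fun _ => aff ℝ)) :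
    IsMultiplicationAlgebra h := by
  let Ψ : semidirect (scalarsPlus h) ≃ₗ[ℝ]
      ((Fin p → ℂ) × (Fin q → ℝ)) × ((Fin p → ℂ) × (Fin q → ℝ)) :=
    Φ.toLinearEquiv.trans (affProdCoords p q)
  have hΨ : ∀ s t, Ψ ⁅s, t⁆ = (0, (Ψ s).1 * (Ψ t).2 - (Ψ t).1 * (Ψ s).2) := fun s t => by
    have h1 : ∀ s, Ψ s = affProdCoords p q (Φ s) := fun _ => rfl
    rw [h1, h1, h1, LieEquiv.map_lie, affProdCoords_lie]
  let inl : (Fin n → ℝ) →ₗ[ℝ] semidirect (scalarsPlus h) :=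
    (SemiDirectSum.inl (mulVecDer (scalarsPlus h)) : _ →ₗ[ℝ] _)
  let inr : scalarsPlus h →ₗ[ℝ] semidirect (scalarsPlus h) :=
    (SemiDirectSum.inr (mulVecDer (scalarsPlus h)) : _ →ₗ[ℝ] _)
  have hlie : ∀ b v, ⁅inr b, inl v⁆ = inl ((b : Matrix (Fin n) (Fin n) ℝ).mulVec v) := fun b v => by
    rw [bracket_semidirect]
    change (⟨_ - Matrix.mulVec 0 _, 0⟩ : semidirect (scalarsPlus h)) = _
    rw [Matrix.zero_mulVec, sub_zero]
    rfl
  have hsum : ∀ s : semidirect (scalarsPlus h), s = inl s.left + inr s.right := fun s => by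
    change s = (⟨s.left + 0, 0 + s.right⟩ : semidirect (scalarsPlus h))
    rw [add_zero, zero_add]
  -- As `I` acts by the identity, each vector is a bracket, and brackets in `A ⋉ A` have first
  -- coordinate zero.
  have hfst : ∀ v, (Ψ (inl v)).1 = 0 := fun v => by
    have h1 := hlie ⟨1, one_mem_scalarsPlus⟩ v
    rw [Matrix.one_mulVec] at h1
    rw [← h1, hΨ]
  let θ : (Fin n → ℝ) →ₗ[ℝ] ((Fin p → ℂ) × (Fin q → ℝ)) :=
    (LinearMap.snd ℝ _ _).comp (Ψ.toLinearMap.comp inl)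
  have hθ : ∀ v, Ψ (inl v) = (0, θ v) := fun v => Prod.ext (hfst v) rfl
  have hbij : Function.Bijective θ := by
    refine ⟨fun v w hvw => ?_, fun a => ?_⟩
    · have h1 : Ψ (inl v) = Ψ (inl w) := by rw [hθ, hθ, hvw]
      exact SemiDirectSum.inl_injective _ (Ψ.injective h1)
    · have h1 : ⁅Ψ.symm (1, 0), Ψ.symm (0, a)⁆ = Ψ.symm (0, a) := by
        apply Ψ.injective
        rw [hΨ]
        simp
      rw [bracket_semidirect] at h1
      refine ⟨(Ψ.symm (0, a)).left, ?_⟩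
      have h4 : (Ψ.symm (0, a)).right = 0 := (congrArg SemiDirectSum.right h1).symm
      have h2 : Ψ.symm (0, a) = inl (Ψ.symm (0, a)).left :=
        (hsum _).trans (by rw [h4, map_zero, add_zero])
      have h3 := hθ (Ψ.symm (0, a)).left
      rw [← h2, Ψ.apply_symm_apply] at h3
      exact (congrArg Prod.snd h3).symm
  let φ := (LinearEquiv.ofBijective θ hbij).symm
  have key : ∀ b : scalarsPlus h,
      mulMatrix φ (Ψ (inr b)).1 = (b : Matrix (Fin n) (Fin n) ℝ) := fun b => by
    refine matrix_ext_mulVec φ fun x => ?_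
    obtain ⟨v, rfl⟩ := hbij.2 x
    have hv : ∀ v, φ (θ v) = v := fun v => (LinearEquiv.ofBijective θ hbij).symm_apply_apply v
    have h1 := hΨ (inr b) (inl v)
    rw [hlie, hθ, hθ, zero_mul, sub_zero] at h1
    have h2 : θ _ = (Ψ (inr b)).1 * θ v := congrArg Prod.snd h1
    rw [mulMatrix_mulVec, ← h2, hv, hv]
  refine ⟨p, q, φ, le_antisymm (fun b hb => ⟨_, key ⟨b, hb⟩⟩) ?_⟩
  rintro _ ⟨a, rfl⟩
  -- The vector component of `Ψ.symm (a, 0)` can be dropped: it contributes nothing to the first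
  -- coordinate.
  have h1 : (Ψ (inr (Ψ.symm (a, 0)).right)).1 = a := by
    have h2 := congrArg (fun s => (Ψ s).1) (hsum (Ψ.symm (a, 0)))
    simp only [map_add, Prod.fst_add, hfst, zero_add, Ψ.apply_symm_apply] at h2
    exact h2.symm
  have h3 := key (Ψ.symm (a, 0)).right
  rw [h1] at h3
  change mulMatrix φ a ∈ (scalarsPlus h).toSubmodule
  rw [h3]
  exact (Ψ.symm (a, 0)).right.2

end Semidirect

/-! ### Complex eigenvalues of real operators -/

section ComplexEigenvalue

variable {V W : Type*} [AddCommGroup V] [Module ℝ V] [AddCommGroup W] [Module ℝ W]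

theorem IsComplexEigenvalue.of_injective {f : Module.End ℝ V} {g : Module.End ℝ W}
    (j : V →ₗ[ℝ] W) (hj : Function.Injective j) (hjf : ∀ x, j (f x) = g (j x)) {μ : ℂ}
    (hμ : IsComplexEigenvalue f μ) : IsComplexEigenvalue g μ := by
  obtain ⟨v, hv⟩ := Module.End.HasEigenvalue.exists_hasEigenvector hμ
  have hJ : Function.Injective (j.baseChange ℂ) :=
    Module.Flat.lTensor_preserves_injective_linearMap j hj
  have hcomp : (j.baseChange ℂ).comp (f.baseChange ℂ) = (g.baseChange ℂ).comp (j.baseChange ℂ) := by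
    rw [← LinearMap.baseChange_comp, ← LinearMap.baseChange_comp]
    exact congrArg _ (LinearMap.ext hjf)
  refine Module.End.hasEigenvalue_of_hasEigenvector (x := j.baseChange ℂ v)
    ⟨Module.End.mem_eigenspace_iff.mpr ?_, fun h0 => hv.2 (hJ (by rw [h0, map_zero]))⟩
  rw [← LinearMap.comp_apply, ← hcomp, LinearMap.comp_apply, hv.apply_eq_smul, map_smul]

/-- The real quadratic is `(f - z)(f - z̄)`. A real left inverse of it therefore excludes `z` from
the complex spectrum. -/
theorem baseChange_quadratic_apply (f : Module.End ℝ V) {μ : ℂ} {v : TensorProduct ℝ ℂ V}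
    (z : ℂ) (hv : f.baseChange ℂ v = μ • v) :
    ((f - z.re • 1) ^ 2 + (z.im ^ 2) • 1 : Module.End ℝ V).baseChange ℂ v =
      ((μ - z) * (μ - star z)) • v := by
  have hre : ∀ (r : ℝ) (w : TensorProduct ℝ ℂ V), (r • (1 : Module.End ℝ V)).baseChange ℂ w =
      (r : ℂ) • w := fun r w => by
    rw [LinearMap.baseChange_smul, LinearMap.smul_apply, LinearMap.baseChange_one]
    rfl
  have h1 : ∀ c : ℂ, (f - z.re • 1 : Module.End ℝ V).baseChange ℂ (c • v) =
      (c * (μ - z.re)) • v := fun c => by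
    rw [map_smul, LinearMap.baseChange_sub, LinearMap.sub_apply, hv, hre, ← sub_smul, smul_smul]
  have h2 := h1 1
  rw [one_smul, one_mul] at h2
  rw [LinearMap.baseChange_add, LinearMap.add_apply, hre, pow_two, LinearMap.baseChange_mul,
    Module.End.mul_apply, h2, h1, ← add_smul]
  congr 1
  apply Complex.ext <;> simp [pow_two] <;> ring

theorem not_isComplexEigenvalue_of_mul_eq_one {f g : Module.End ℝ V} {μ : ℂ}
    (h : g * ((f - μ.re • 1) ^ 2 + (μ.im ^ 2) • 1) = 1) : ¬ IsComplexEigenvalue f μ := fun hμ => by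
  obtain ⟨v, hv⟩ := Module.End.HasEigenvalue.exists_hasEigenvector hμ
  have h1 := baseChange_quadratic_apply f μ hv.apply_eq_smul
  rw [sub_self, zero_mul, zero_smul] at h1
  have h2 := congrArg (fun k : Module.End ℝ V => k.baseChange ℂ v) h
  simp only [LinearMap.baseChange_mul, Module.End.mul_apply, LinearMap.baseChange_one] at h2
  rw [h1, map_zero] at h2
  exact hv.2 h2.symm

/-- The complexified operator satisfies `(F - w)(F - w̄) u = 0` at `u = 1 ⊗ y c ≠ 0`, so either `u`
is an eigenvector for `w̄` or `(F - w̄) u` is one for `w`. -/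
theorem isComplexEigenvalue_or_of_apply_eq (f : Module.End ℝ V) (y : ℂ →ₗ[ℝ] V) {w : ℂ}
    (hy : ∀ c, f (y c) = y (w * c)) {c : ℂ} (hc : y c ≠ 0) :
    IsComplexEigenvalue f w ∨ IsComplexEigenvalue f (star w) := by
  set F := f.baseChange ℂ
  let u : ℂ → TensorProduct ℝ ℂ V := fun c => TensorProduct.tmul ℝ (1 : ℂ) (y c)
  have hu : ∀ c, F (u c) = u (w * c) := fun c => by
    simp only [F, u, LinearMap.baseChange_tmul, hy]
  have hu0 : u c ≠ 0 := fun h0 => hc <| by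
    exact Module.FaithfullyFlat.tensorProduct_mk_injective (A := ℝ) (B := ℂ) V (by simpa [u] using h0)
  by_cases hz : F (u c) = star w • u c
  · exact .inr (Module.End.hasEigenvalue_of_hasEigenvector
      ⟨Module.End.mem_eigenspace_iff.mpr hz, hu0⟩)
  refine .inl (Module.End.hasEigenvalue_of_hasEigenvector
    ⟨Module.End.mem_eigenspace_iff.mpr ?_, sub_ne_zero.mpr hz⟩)
  change F _ = _
  have hadd : u (w * (w * c)) + (w * star w) • u c = (w + star w) • u (w * c) := by
    have e1 : w * star w = ((Complex.normSq w : ℝ) : ℂ) := Complex.mul_conj w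
    have e2 : w + star w = ((2 * w.re : ℝ) : ℂ) := Complex.add_conj w
    have hs : ∀ (r : ℝ) c, (r : ℂ) • u c = u (r • c) := fun r c => by
      simp only [u, map_smul, TensorProduct.tmul_smul]
      rfl
    have ha : ∀ c d, u c + u d = u (c + d) := fun c d => by
      simp only [u, map_add, TensorProduct.tmul_add]
    rw [e1, e2, hs, hs, ha]
    congr 1
    rw [Complex.real_smul, Complex.real_smul, ← e1, ← e2]
    ring
  rw [map_sub, map_smul, hu, hu]
  linear_combination (norm := module) hadd

end ComplexEigenvalue

/-! ### Bounding the spectrum of `ad x` by that of `x` -/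

section AdEigenvalue

variable {n : ℕ} {h : LieSubalgebra ℝ (slR n)}

theorem mem_of_isComplexEigenvalue_mulLeft {X : Matrix (Fin n) (Fin n) ℝ} {S : Submodule ℝ ℂ}
    (hX : ∀ μ : ℂ, μ ∉ S → IsUnit ((X - μ.re • 1) ^ 2 + (μ.im ^ 2) • 1)) (μ : ℂ)
    (hμ : IsComplexEigenvalue (LinearMap.mulLeft ℝ X) μ) : μ ∈ S := by
  by_contra hS
  obtain ⟨B, hB⟩ := (hX μ hS).exists_left_inv
  refine not_isComplexEigenvalue_of_mul_eq_one (g := LinearMap.mulLeft ℝ B) ?_ hμ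
  refine LinearMap.ext fun Y => ?_
  have h1 := congrArg (· * Y) hB
  rw [one_mul] at h1
  rw [Module.End.one_apply]
  conv_rhs => rw [← h1]
  simp [pow_two, mul_add, add_mul, mul_sub, sub_mul, mul_assoc]

theorem mem_of_isComplexEigenvalue_mulRight {X : Matrix (Fin n) (Fin n) ℝ} {S : Submodule ℝ ℂ}
    (hX : ∀ μ : ℂ, μ ∉ S → IsUnit ((X - μ.re • 1) ^ 2 + (μ.im ^ 2) • 1)) (μ : ℂ)
    (hμ : IsComplexEigenvalue (LinearMap.mulRight ℝ X) μ) : μ ∈ S := by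
  by_contra hS
  obtain ⟨B, hB⟩ := (hX μ hS).exists_right_inv
  refine not_isComplexEigenvalue_of_mul_eq_one (g := LinearMap.mulRight ℝ B) ?_ hμ
  refine LinearMap.ext fun Y => ?_
  have h1 := congrArg (Y * ·) hB
  rw [mul_one] at h1
  rw [Module.End.one_apply]
  conv_rhs => rw [← h1]
  simp [pow_two, mul_add, add_mul, mul_sub, sub_mul, mul_assoc]

/-- `ad x` is the restriction of the sum of two commuting operators, left multiplication by `x` and
right multiplication by `-x`, and `S` is closed under sums and negation. -/
theorem mem_of_isComplexEigenvalue_ad {x : slR n} {S : Submodule ℝ ℂ}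
    (hX : ∀ μ : ℂ, μ ∉ S → IsUnit (((x : Matrix (Fin n) (Fin n) ℝ) - μ.re • 1) ^ 2 +
      (μ.im ^ 2) • 1)) (μ : ℂ) (hμ : IsComplexEigenvalue (ad ℝ (slR n) x) μ) : μ ∈ S := by
  have hX' : ∀ μ : ℂ, μ ∉ S → IsUnit ((-(x : Matrix (Fin n) (Fin n) ℝ) - μ.re • 1) ^ 2 +
      (μ.im ^ 2) • 1) := fun μ hμ => by
    have := hX (-μ) (by rwa [neg_mem_iff])
    rw [← neg_sq]
    simpa [add_comm] using this
  refine mem_add_of_commute (f := LinearMap.mulLeft ℝ (x : Matrix (Fin n) (Fin n) ℝ))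
    (g := LinearMap.mulRight ℝ (-(x : Matrix (Fin n) (Fin n) ℝ)))
    (LinearMap.commute_mulLeft_right _ _) S (mem_of_isComplexEigenvalue_mulLeft hX)
    (mem_of_isComplexEigenvalue_mulRight hX') μ
    (hμ.of_injective (slR n).toSubmodule.subtype Subtype.val_injective fun y => ?_)
  change (x : Matrix (Fin n) (Fin n) ℝ) * y - y * x = x * y + y * (-x)
  rw [mul_neg, sub_eq_add_neg]

end AdEigenvalue

/-! ### Character differences as eigenvalues of `ad x` -/

section Characters

variable {n p q : ℕ}

/-- A real linear map from `ℂ` onto the factor on which `character i` lives, intertwining the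
multiplication by `character i a` with the multiplication by `a`. -/
noncomputable def characterSection :
    Fin p ⊕ Fin p ⊕ Fin q → (ℂ →ₗ[ℝ] ((Fin p → ℂ) × (Fin q → ℝ)))
  | .inl j => (LinearMap.inl ℝ _ _).comp (LinearMap.single ℝ (fun _ : Fin p => ℂ) j)
  | .inr (.inl j) => (LinearMap.inl ℝ _ _).comp ((LinearMap.single ℝ (fun _ : Fin p => ℂ) j).comp
      (Complex.conjAe : ℂ →ₗ[ℝ] ℂ))
  | .inr (.inr k) => (LinearMap.inr ℝ _ _).comp ((LinearMap.single ℝ (fun _ : Fin q => ℝ) k).comp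
      Complex.reLm)

theorem mul_characterSection (i : Fin p ⊕ Fin p ⊕ Fin q) (a : (Fin p → ℂ) × (Fin q → ℝ)) (c : ℂ) :
    a * characterSection i c = characterSection i (character i a * c) := by
  rcases i with j | j | k
  · refine Prod.ext ?_ (mul_zero _)
    simp [characterSection, character, ← Pi.single_mul_right]
  · refine Prod.ext ?_ (mul_zero _)
    simp [characterSection, character, ← Pi.single_mul_right]
  · refine Prod.ext (mul_zero _) ?_
    simp [characterSection, character, ← Pi.single_mul_right]

theorem characterSection_one_ne_zero (i : Fin p ⊕ Fin p ⊕ Fin q) :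
    (characterSection i 1 : (Fin p → ℂ) × (Fin q → ℝ)) ≠ 0 := by
  rcases i with j | j | k <;> simp [characterSection, Prod.ext_iff]

/-- The operator `b ↦ sᵢ(c χⱼ(b))`, with `sᵢ` the section of the `i`-th character, plays the role of
a matrix unit: bracketing with `x` multiplies `c` by `w = χᵢ(a) - χⱼ(a)`. So `w` or its conjugate is
an eigenvalue. -/
theorem character_sub_character_mem (φ : ((Fin p → ℂ) × (Fin q → ℝ)) ≃ₗ[ℝ] (Fin n → ℝ))
    {x : slR n} {a : (Fin p → ℂ) × (Fin q → ℝ)} (hxa : mulMatrix φ a = x) {S : Submodule ℝ ℂ}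
    (hS : ∀ z, star z ∈ S → z ∈ S) (hx : ∀ μ, IsComplexEigenvalue (ad ℝ (slR n) x) μ → μ ∈ S)
    (i j : Fin p ⊕ Fin p ⊕ Fin q) : character i a - character j a ∈ S := by
  set w := character i a - character j a with hw
  rcases eq_or_ne w 0 with hw0 | hw0
  · rw [hw0]; exact S.zero_mem
  let Y : ℂ →ₗ[ℝ] Matrix (Fin n) (Fin n) ℝ :=
    { toFun := fun c => LinearMap.toMatrix' (φ.conj ((characterSection i).comp
        ((LinearMap.mulLeft ℝ c).comp (character j).toLinearMap)))
      map_add' := fun c d => by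
        rw [← map_add, ← map_add, ← LinearMap.comp_add, ← LinearMap.add_comp]
        congr 4
        ext
        simp [add_mul]
      map_smul' := fun r c => by
        rw [RingHom.id_apply, ← map_smul, ← map_smul, ← LinearMap.comp_smul, ← LinearMap.smul_comp]
        congr 4
        ext
        simp }
  have hY : ∀ c b, (Y c).mulVec (φ b) = φ (characterSection i (c * character j b)) := fun c b => by
    have h1 : Y c = LinearMap.toMatrix' (φ.conj ((characterSection i).comp
        ((LinearMap.mulLeft ℝ c).comp (character j).toLinearMap))) := rfl
    rw [h1, LinearMap.toMatrix'_mulVec]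
    simp [LinearEquiv.conj_apply]
  have hbr : ∀ c, (x : Matrix (Fin n) (Fin n) ℝ) * Y c - Y c * x = Y (w * c) := fun c => by
    refine matrix_ext_mulVec φ fun b => ?_
    rw [← hxa, Matrix.sub_mulVec, ← Matrix.mulVec_mulVec, ← Matrix.mulVec_mulVec,
      mulMatrix_mulVec, hY, hY, mulMatrix_mulVec, hY, mul_characterSection, ← map_sub, ← map_sub,
      map_mul, hw]
    congr 2
    ring
  -- For `w ≠ 0`, `Y c` is the commutator of `x` with `Y (c / w)`, so it lies in `sl(n)`.
  have htr : ∀ c, (Y c).trace = 0 := fun c => by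
    rw [← mul_div_cancel₀ c hw0, ← hbr, Matrix.trace_sub, Matrix.trace_mul_comm, sub_self]
  let y : ℂ →ₗ[ℝ] slR n := Y.codRestrict (slR n).toSubmodule htr
  have hy : ∀ c, ad ℝ (slR n) x (y c) = y (w * c) := fun c => Subtype.ext (hbr c)
  have hy1 : y 1 ≠ 0 := fun h0 => by
    have h1 : Y 1 = 0 := congrArg Subtype.val h0
    have h2 := hY 1 1
    rw [h1, Matrix.zero_mulVec, map_one, mul_one, eq_comm, map_eq_zero_iff φ φ.injective] at h2
    exact characterSection_one_ne_zero i h2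
  rcases isComplexEigenvalue_or_of_apply_eq _ y hy hy1 with h1 | h1
  · exact hx _ h1
  · exact hS _ (hx _ h1)

theorem trace_mulMatrix (φ : ((Fin p → ℂ) × (Fin q → ℝ)) ≃ₗ[ℝ] (Fin n → ℝ))
    (a : (Fin p → ℂ) × (Fin q → ℝ)) : (mulMatrix φ a).trace = Algebra.trace ℝ _ a := by
  have h1 : Matrix.toLin' (mulMatrix φ a) = φ.conj (Algebra.lmul ℝ _ a) := by
    rw [show mulMatrix φ a = LinearMap.toMatrix' (φ.conj (Algebra.lmul ℝ _ a)) from rfl,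
      Matrix.toLin'_toMatrix']
  rw [Algebra.trace_apply, ← LinearMap.trace_conj' _ φ, ← h1, Matrix.trace_toLin'_eq]

/-- Conjugation is a real algebra automorphism, so it preserves the trace of the regular
representation. -/
theorem trace_mulMatrix_star (φ : ((Fin p → ℂ) × (Fin q → ℝ)) ≃ₗ[ℝ] (Fin n → ℝ))
    (a : (Fin p → ℂ) × (Fin q → ℝ)) : (mulMatrix φ (star a)).trace = (mulMatrix φ a).trace := by
  let e : ((Fin p → ℂ) × (Fin q → ℝ)) ≃ₐ[ℝ] ((Fin p → ℂ) × (Fin q → ℝ)) :=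
    AlgEquiv.ofRingEquiv (f := starRingAut) fun r => by
      ext <;> simp
  rw [trace_mulMatrix, trace_mulMatrix, ← Algebra.trace_eq_of_algEquiv e a]
  rfl

theorem trace_mulMatrix_eq_zero (φ : ((Fin p → ℂ) × (Fin q → ℝ)) ≃ₗ[ℝ] (Fin n → ℝ))
    {a : (Fin p → ℂ) × (Fin q → ℝ)} (ha : star a = -a) : (mulMatrix φ a).trace = 0 := by
  have h1 := trace_mulMatrix_star φ a
  rw [ha, map_neg, Matrix.trace_neg] at h1
  linarith

theorem isUnit_quadratic (a : (Fin p → ℂ) × (Fin q → ℝ)) (s t : ℝ)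
    (h1 : ∀ j, (a.1 j - s) ^ 2 + t ^ 2 ≠ 0) (h2 : ∀ k, (a.2 k - s) ^ 2 + t ^ 2 ≠ 0) :
    IsUnit ((a - s • 1) ^ 2 + (t ^ 2) • 1) := by
  rw [Prod.isUnit_iff, Pi.isUnit_iff, Pi.isUnit_iff]
  refine ⟨fun j => isUnit_iff_ne_zero.mpr ?_, fun k => isUnit_iff_ne_zero.mpr ?_⟩
  · simpa using h1 j
  · simpa using h2 k

theorem isUnit_quadratic_mulMatrix (φ : ((Fin p → ℂ) × (Fin q → ℝ)) ≃ₗ[ℝ] (Fin n → ℝ))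
    {a : (Fin p → ℂ) × (Fin q → ℝ)} {s t : ℝ} (ha : IsUnit ((a - s • 1) ^ 2 + (t ^ 2) • 1)) :
    IsUnit ((mulMatrix φ a - s • 1) ^ 2 + (t ^ 2) • 1) := by
  simpa using ha.map (mulMatrix φ)

end Characters

/-! ### Dimensions of the toroidal and vector parts -/

section Parts

variable {n p q : ℕ} {h : LieSubalgebra ℝ (slR n)} [IsLieAbelian h]
  (φ : ((Fin p → ℂ) × (Fin q → ℝ)) ≃ₗ[ℝ] (Fin n → ℝ))

theorem mem_toroidalPart_iff (hn : 1 ≤ n)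
    (hφ : (scalarsPlus h).toSubmodule = Subalgebra.toSubmodule (mulMatrix φ).range) {x : slR n} :
    x ∈ toroidalPart h ↔ ∃ y : Fin p → ℝ, mulMatrix φ (fun j => y j * Complex.I, 0) = x := by
  have hmem : ∀ X, X ∈ scalarsPlus h ↔ ∃ a, mulMatrix φ a = X := fun X => by
    rw [← LieSubalgebra.mem_toSubmodule, hφ]; rfl
  constructor
  · rintro ⟨hxh, hx⟩
    obtain ⟨a, ha⟩ := (hmem _).mp (coe_mem_scalarsPlus hxh)
    have hre : ∀ i j : Fin p ⊕ Fin p ⊕ Fin q, (character i a).re = (character j a).re :=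
      fun i j => by
        have := character_sub_character_mem φ ha (fun z hz => by simpa using hz) hx i j
        simpa [sub_eq_zero] using this
    have hne : Nonempty (Fin p ⊕ Fin p ⊕ Fin q) := by
      have hdim : 2 * p + q = n := by
        rw [← finrank_pi_complex_prod_pi_real, φ.finrank_eq]; simp
      rcases Nat.eq_zero_or_pos p with hp | hp
      · exact ⟨.inr (.inr ⟨0, by omega⟩)⟩
      · exact ⟨.inl ⟨0, hp⟩⟩
    obtain ⟨i⟩ := hne
    set r := (character i a).re with hr
    have h1 : ∀ j, (a.1 j).re = r := fun j => hre (.inl j) i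
    have h2 : ∀ k, a.2 k = r := fun k => hre (.inr (.inr k)) i
    -- All characters of `a` share the real part `r`. The imaginary part is traceless, so the trace
    -- of `x` is `n r`, which forces `r = 0`.
    have h3 : a = ((fun j => (a.1 j).im * Complex.I, 0) : (Fin p → ℂ) × (Fin q → ℝ)) + r • 1 := by
      refine Prod.ext (funext fun j => ?_) (funext fun k => ?_)
      · apply Complex.ext <;> simp [h1]
      · simp [h2]
    have htr : (mulMatrix φ ((fun j => (a.1 j).im * Complex.I, 0) :
        (Fin p → ℂ) × (Fin q → ℝ))).trace = 0 := trace_mulMatrix_eq_zero φ <| by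
      ext j <;> simp
    have h4 := trace_coe_slR x
    rw [← ha, h3, map_add, map_smul, map_one, Matrix.trace_add, htr, Matrix.trace_smul,
      Matrix.trace_one, Fintype.card_fin, zero_add, smul_eq_mul, mul_eq_zero] at h4
    have hn0 : (n : ℝ) ≠ 0 := by exact_mod_cast Nat.one_le_iff_ne_zero.mp hn
    refine ⟨fun j => (a.1 j).im, ?_⟩
    rw [← ha]
    conv_rhs => rw [h3, h4.resolve_right hn0, zero_smul, add_zero]
  · rintro ⟨y, hy⟩
    refine ⟨mem_of_coe_mem_scalarsPlus hn ((hmem _).mpr ⟨_, hy⟩),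
      mem_of_isComplexEigenvalue_ad fun μ hμ => ?_⟩
    rw [← hy]
    have hμ' : μ.re ≠ 0 := hμ
    refine isUnit_quadratic_mulMatrix φ (isUnit_quadratic _ _ _ (fun j h0 => ?_) fun k h0 => ?_)
    -- The quadratic splits into two factors, each with real part `-μ.re ≠ 0`.
    · have h1 : ((y j - μ.im) * Complex.I - μ.re) * ((y j + μ.im) * Complex.I - μ.re) = 0 := by
        rw [← h0]
        linear_combination (-(μ.im : ℂ) ^ 2) * Complex.I_sq
      rcases mul_eq_zero.mp h1 with h2 | h2 <;>
      · have := congrArg Complex.re h2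
        simp at this
        exact hμ' this
    · have : 0 < ((0 : Fin q → ℝ) k - μ.re) ^ 2 := by simpa using sq_pos_of_ne_zero hμ'
      nlinarith [sq_nonneg μ.im]

theorem mem_vectorPart_iff (hn : 1 ≤ n)
    (hφ : (scalarsPlus h).toSubmodule = Subalgebra.toSubmodule (mulMatrix φ).range) {x : slR n} :
    x ∈ vectorPart h ↔ ∃ r : (Fin p → ℝ) × (Fin q → ℝ),
      mulMatrix φ (fun j => (r.1 j : ℂ), r.2) = x := by
  have hmem : ∀ X, X ∈ scalarsPlus h ↔ ∃ a, mulMatrix φ a = X := fun X => by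
    rw [← LieSubalgebra.mem_toSubmodule, hφ]; rfl
  constructor
  · rintro ⟨hxh, hx⟩
    obtain ⟨a, ha⟩ := (hmem _).mp (coe_mem_scalarsPlus hxh)
    have him : ∀ j, (a.1 j).im = 0 := fun j => by
      -- A complex character minus its conjugate is twice its imaginary part times `i`, which is
      -- real only if it is zero.
      have h1 := character_sub_character_mem φ ha (fun z hz => by simpa using hz) hx
        (.inl j) (.inr (.inl j))
      have h2 : (a.1 j).im - (star (a.1 j)).im = 0 := h1
      rw [Complex.star_def, Complex.conj_im] at h2
      linarith
    refine ⟨(fun j => (a.1 j).re, a.2), ?_⟩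
    rw [← ha]
    congr 1
    refine Prod.ext (funext fun j => ?_) rfl
    apply Complex.ext <;> simp [him]
  · rintro ⟨r, hr⟩
    refine ⟨mem_of_coe_mem_scalarsPlus hn ((hmem _).mpr ⟨_, hr⟩),
      mem_of_isComplexEigenvalue_ad fun μ hμ => ?_⟩
    rw [← hr]
    have hμ' : μ.im ≠ 0 := hμ
    have hpos : ∀ s : ℝ, (s - μ.re) ^ 2 + μ.im ^ 2 ≠ 0 := fun s => by positivity
    exact isUnit_quadratic_mulMatrix φ (isUnit_quadratic _ _ _
      (fun j => by
        change ((r.1 j : ℂ) - (μ.re : ℂ)) ^ 2 + (μ.im : ℂ) ^ 2 ≠ 0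
        exact_mod_cast hpos (r.1 j)) fun k => hpos (r.2 k))

theorem finrank_toroidalPart (hn : 1 ≤ n)
    (hφ : (scalarsPlus h).toSubmodule = Subalgebra.toSubmodule (mulMatrix φ).range) :
    finrank ℝ (toroidalPart h) = p := by
  let f : (Fin p → ℝ) →ₗ[ℝ] Matrix (Fin n) (Fin n) ℝ :=
    (mulMatrix φ).toLinearMap.comp ((LinearMap.inl ℝ _ _).comp
      (LinearMap.pi fun j => (LinearMap.toSpanSingleton ℝ ℂ Complex.I).comp (LinearMap.proj j)))
  have hf : ∀ y, f y = mulMatrix φ (fun j => y j * Complex.I, 0) := fun y => by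
    simp [f]
    rfl
  have hinj : Function.Injective f := fun y z hyz => by
    rw [hf, hf] at hyz
    have h1 := congrArg Prod.fst (mulMatrix_injective φ hyz)
    funext j
    simpa using congrFun h1 j
  have htr : ∀ y, (f y).trace = 0 := fun y => by
    rw [hf]
    refine trace_mulMatrix_eq_zero φ ?_
    ext j <;> simp
  let g : (Fin p → ℝ) →ₗ[ℝ] slR n := f.codRestrict (slR n).toSubmodule htr
  have hg : LinearMap.range g = toroidalPart h := by
    ext x
    rw [mem_toroidalPart_iff φ hn hφ, LinearMap.mem_range]
    refine exists_congr fun y => ?_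
    rw [← hf, Subtype.ext_iff]
    rfl
  rw [← hg, LinearMap.finrank_range_of_inj fun y z hyz => hinj (congrArg Subtype.val hyz)]
  simp

/-- The real tuples have dimension `p + q`; the vector part is the kernel on them of the trace,
which is nonzero at `1`. -/
theorem finrank_vectorPart (hn : 1 ≤ n)
    (hφ : (scalarsPlus h).toSubmodule = Subalgebra.toSubmodule (mulMatrix φ).range) :
    finrank ℝ (vectorPart h) + 1 = p + q := by
  let f : ((Fin p → ℝ) × (Fin q → ℝ)) →ₗ[ℝ] Matrix (Fin n) (Fin n) ℝ :=
    (mulMatrix φ).toLinearMap.comp (LinearMap.prodMap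
      (LinearMap.pi fun j => Complex.ofRealAm.toLinearMap.comp (LinearMap.proj j)) LinearMap.id)
  have hf : ∀ r, f r = mulMatrix φ (fun j => (r.1 j : ℂ), r.2) := fun r => rfl
  have hinj : Function.Injective f := fun y z hyz => by
    rw [hf, hf] at hyz
    have h1 := mulMatrix_injective φ hyz
    rw [Prod.mk.injEq] at h1
    refine Prod.ext (funext fun j => ?_) h1.2
    simpa using congrFun h1.1 j
  let t : ((Fin p → ℝ) × (Fin q → ℝ)) →ₗ[ℝ] ℝ := (Matrix.traceLinearMap (Fin n) ℝ ℝ).comp f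
  have ht : t 1 ≠ 0 := by
    have h1 : f 1 = 1 := by
      rw [hf, ← map_one (mulMatrix φ)]
      rfl
    change (f 1).trace ≠ 0
    rw [h1, Matrix.trace_one, Fintype.card_fin]
    exact_mod_cast Nat.one_le_iff_ne_zero.mp hn
  let g : LinearMap.ker t →ₗ[ℝ] slR n :=
    (f.comp (LinearMap.ker t).subtype).codRestrict (slR n).toSubmodule fun r => r.2
  have hg : LinearMap.range g = vectorPart h := by
    ext x
    rw [mem_vectorPart_iff φ hn hφ, LinearMap.mem_range]
    constructor
    · rintro ⟨r, rfl⟩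
      exact ⟨r, rfl⟩
    · rintro ⟨r, hr⟩
      refine ⟨⟨r, ?_⟩, Subtype.ext hr⟩
      change (f r).trace = 0
      rw [hf, hr, trace_coe_slR]
  have hrange : finrank ℝ (LinearMap.range t) = 1 := by
    rw [LinearMap.range_eq_top.mpr (LinearMap.surjective fun h0 => ht (by rw [h0]; rfl))]
    simp
  have hsum := t.finrank_range_add_finrank_ker
  rw [← hg, LinearMap.finrank_range_of_inj fun y z hyz =>
    Subtype.ext (hinj (congrArg Subtype.val hyz))]
  rw [hrange, finrank_prod, finrank_fin_fun, finrank_fin_fun] at hsum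
  omega

end Parts

end CartanSl

/-- The relation for `q` is additive because natural subtraction would truncate when `q = 0`, where
the vector part has dimension `p - 1`. -/
theorem mainTheorem6 (n : ℕ) (hn : 1 ≤ n) (h : LieSubalgebra ℝ (CartanSl.slR n))
    [IsLieAbelian h] :
    List.TFAE [
      h.IsCartanSubalgebra,
      ∃ M : Matrix (Fin n) (Fin n) ℝ,
        CartanSl.IsNonderogatory M ∧ CartanSl.HasDistinctEigenvalues M ∧
          (CartanSl.scalarsPlus h).toSubmodule =
            Subalgebra.toSubmodule (Algebra.adjoin ℝ {M}),
      ∃ p q : ℕ,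
        p = Module.finrank ℝ (CartanSl.toroidalPart h) ∧
        q + Module.finrank ℝ (CartanSl.toroidalPart h) =
          Module.finrank ℝ (CartanSl.vectorPart h) + 1 ∧
        Nonempty (CartanSl.semidirect (CartanSl.scalarsPlus h) ≃ₗ⁅ℝ⁆
          (DirectSum (Fin p) fun _ => CartanSl.aff ℂ) ×
            (DirectSum (Fin q) fun _ => CartanSl.aff ℝ))] := by
  tfae_have 1 → 2 := fun hC =>
    CartanSl.exists_isNonderogatory_of_isMultiplicationAlgebra
      (CartanSl.isMultiplicationAlgebra_of_isCartanSubalgebra hn hC)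
  tfae_have 2 → 3 := by
    rintro ⟨M, hM, hM', hh⟩
    obtain ⟨p, q, φ, hφ⟩ := CartanSl.isMultiplicationAlgebra_of_isNonderogatory hM hM' hh
    have hp := CartanSl.finrank_toroidalPart φ hn hφ
    have hq := CartanSl.finrank_vectorPart φ hn hφ
    exact ⟨p, q, hp.symm, by omega, CartanSl.nonempty_lieEquiv_of_eq_range_mulMatrix φ hφ⟩
  tfae_have 3 → 1 := by
    rintro ⟨p, q, -, -, ⟨Φ⟩⟩
    exact CartanSl.isCartanSubalgebra_of_isMultiplicationAlgebra hn
      (CartanSl.isMultiplicationAlgebra_of_lieEquiv Φ)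
  tfae_finish
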